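/- **Setting.** Let $f:\mathbb R^n\times\mathbb R^m\to\mathbb R^n$ be continuous with $|f(x,y)|\le a+b|x|$ for all $x,y$, for some $a,b>0$. Let $g:\mathbb R^n\times\mathbb R^m\times\mathbb R\to\mathbb R^m$, $(x,y,\tau)\mapsto g(x,y,\tau)$, be bounded and uniformly continuous on $K\times\mathbb R$ for every compact $K\subset\mathbb R^n\times\mathbb R^m$, and such that for all compact $K_0\subset\mathbb R^n$, $K\subset\mathbb R^m$ there is $L$ with $|g(x,y_1,\tau)-g(x,y_2,\tau)|\le L|y_1-y_2|$ for $x\in K_0$, $y_1,y_2\in K$, $\tau\in\mathbb R$. For a continuous map $h(x,y,\tau)$ put $(h\cdot s)(x,y,\tau)=h(x,y,\tau+s)$. Let $\mathcal H$ be the hull of $g$, i.e. the closure of $\{g\cdot s\mid s\in\mathbb R\}$ in the compact-open topology, let $d$ be a metric on $\mathcal H$ inducing this topology, and let $\mathcal O(g)=\bigcap_{T}\overline{\{g\cdot\tau\mid\tau\ge T\}}\subset\mathcal H$ be the omega-limit set of $g$. Let $y(\tau,h,x,\tau_0,y_0)$ denote the solution of $y'=h(x,y,\tau)$, $y(\tau_0)=y_0$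 ($x$ being a fixed parameter), and $y(\tau,h,x,y_0)=y(\tau,h,x,0,y_0)$. Assume that * for all $h\in\{g\cdot\tau_0\mid\tau_0\ge0\}\cup\mathcal O(g)$, $x\in\mathbb R^n$, $y_0\in\mathbb R^m$, the solution $y(\tau,h,x,y_0)$ is defined for all $\tau\ge0$; * for every compact $K_0\subset\mathbb R^n$ there is $c>0$ such that for every $\rho>0$ there is $T\ge 0$ with $|y(\tau+\tau_0,g,x,\tau_0,y_0)|\le c$ whenever $x\in K_0$, $\tau_0\ge0$, $\tau\ge T$, $|y_0|\le \rho$. Fix $t_0>0$, initial values $\xi\in\mathbb R^n$, $\eta\in\mathbb R^m$ and a sequence $\varepsilon_k>0$, $\varepsilon_k\to0$. For each $k$ let $(x_{\varepsilon_k},y_{\varepsilon_k})$ be a solution on $[0,t_0]$ of $$\dot x=f(x,y),\qquad \varepsilon_k\,\dot y=g(x,y,t/\varepsilon_k),\qquad x(0)=\xi,\ y(0)=\eta ,$$ and suppose that $x_{\varepsilon_k}\to x_0$ uniformly on $[0,t_0]$. Below, $y_{\varepsilon_k}(\tau)$ is written in the fast time $\tau=t/\varepsilon_k$, so that $y_{\varepsilon_k}(t_0/\varepsilon_k)$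 is its value at the slow time $t=t_0$. Fix $r>0$ and let $$K_0=\{x_0(t)+v\mid t\in[0,t_0],\ |v|\le r\}.$$ Let $\pi_\tau(h,x,y_0)=(h\cdot\tau,x,y(\tau,h,x,y_0))$, $\tau\ge0$, on $\mathcal O(g)\times K_0\times\mathbb R^m$. A global attractor of $\pi$ is a compact set $\mathbb A\subset\mathcal O(g)\times K_0\times\mathbb R^m$ with $\pi_\tau(\mathbb A)=\mathbb A$ for all $\tau\ge0$ and $\lim_{\tau\to\infty}\sup_{p\in\pi_\tau(\mathcal O(g)\times K_0\times D)}{\rm dist}(p,\mathbb A)=0$ for every bounded $D\subset\mathbb R^m$. Its fibers are $A_{(h,x)}=\{y\mid(h,x,y)\in\mathbb A\}$. For $h\in\mathcal H$, $x\in K_0$ and $\delta\ge{\rm dist}(h,\mathcal O(g))$ put $$B_{(h,x)}[\delta]=\bigcup\big\{A_{(\tilde h,\tilde x)}\ \big|\ (\tilde h,\tilde x)\in\mathcal O(g)\times K_0,\ d(\tilde h,h)\le\delta,\ |\tilde x-x|\le\delta\big\}.$$ **Theorem.** The semiflow $\pi$ has a unique global attractor $\mathbb A$. For each $k$ let $$\delta_k=\inf\Big\{\delta>0\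 \Big|\ {\rm dist}\big(g\cdot(t_0/\varepsilon_k),\mathcal O(g)\big)\le\delta\ \text{ and }\ {\rm dist}\big(y_{\varepsilon_k}(t_0/\varepsilon_k),B_{(g\cdot(t_0/\varepsilon_k),x_0(t_0))}[\delta]\big)\le\delta\Big\},$$ the infimum being over a nonempty set. Then: 1. $\lim_{k\to\infty}\delta_k=0$; 2. $\lim_{k\to\infty}{\rm dist}\big(y_{\varepsilon_k}(t_0/\varepsilon_k),B_{(g\cdot(t_0/\varepsilon_k),x_0(t_0))}[\delta_k]\big)=0$; 3. if $g\cdot(t_0/\varepsilon_k)\to h_0$ in $(\mathcal H,d)$ as $k\to\infty$, then $h_0\in\mathcal O(g)$ and $\lim_{k\to\infty}{\rm dist}\big(y_{\varepsilon_k}(t_0/\varepsilon_k),A_{(h_0,x_0(t_0))}\big)=0$. -/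

import Mathlib

open Set Filter Topology

namespace SlowFast

/-- The Euclidean space `ℝⁿ`. -/
abbrev Vec (n : ℕ) : Type := EuclideanSpace ℝ (Fin n)

/-- Continuous maps `h(x, y, τ)` from `ℝⁿ × ℝᵐ × ℝ` to `ℝᵐ`; the topology of this type is the
compact-open topology. -/
abbrev FastField (n m : ℕ) : Type := C(Vec n × Vec m × ℝ, Vec m)

/-- The translate `(h·s)(x, y, τ) = h(x, y, τ + s)`. -/
def shift {n m : ℕ} (s : ℝ) (h : FastField n m) : FastField n m :=
  ⟨fun p => h (p.1, p.2.1, p.2.2 + s), by fun_prop⟩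

theorem continuous_shift {n m : ℕ} (s : ℝ) :
    Continuous (shift s : FastField n m → FastField n m) :=
  ContinuousMap.continuous_precomp
    (⟨fun p => (p.1, p.2.1, p.2.2 + s), by fun_prop⟩ :
      C(Vec n × Vec m × ℝ, Vec n × Vec m × ℝ))

theorem shift_shift {n m : ℕ} (s r : ℝ) (h : FastField n m) :
    shift s (shift r h) = shift (s + r) h := by
  ext p
  simp [shift, add_assoc]

/-- The hull of `g`: the closure of its translates in the compact-open topology. The type carries
no built-in topology or metric; a metric on it is always given explicitly. -/
def Hull {n m : ℕ} (g : FastField n m) : Type :=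
  {h : FastField n m // h ∈ closure (range fun s : ℝ => shift s g)}

/-- The map represented by a point of the hull. -/
def Hull.field {n m : ℕ} {g : FastField n m} (h : Hull g) : FastField n m := Subtype.val h

/-- The map `g` itself, as a point of its hull. -/
def Hull.base {n m : ℕ} (g : FastField n m) : Hull g :=
  ⟨g, subset_closure ⟨0, by ext p; simp [shift]⟩⟩

/-- The shift flow `(τ, h) ↦ h·τ` on the hull. -/
def Hull.flow {n m : ℕ} {g : FastField n m} (τ : ℝ) (h : Hull g) : Hull g :=
  ⟨shift τ h.field, by
    refine map_mem_closure (continuous_shift τ) (Subtype.property h) ?_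
    rintro _ ⟨s, rfl⟩
    exact ⟨τ + s, (shift_shift τ s g).symm⟩⟩

/-- The given metric of the hull induces the compact-open topology. -/
def IsHullMetric {n m : ℕ} (g : FastField n m) [MetricSpace (Hull g)] : Prop :=
  IsEmbedding (Hull.field : Hull g → FastField n m)

/-- The omega-limit set `𝒪(g)` of `g` in its hull. -/
def omegaSet {n m : ℕ} (g : FastField n m) [MetricSpace (Hull g)] : Set (Hull g) :=
  omegaLimit atTop (fun (τ : ℝ) (h : Hull g) => h.flow τ) {Hull.base g}

/-- `u` solves the layer equation `y' = h(x, y, τ)`, `y(τ₀) = y₀`, on `[τ₀, ∞)`. -/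
def IsLayerSolution {n m : ℕ} (h : FastField n m) (x : Vec n) (τ₀ : ℝ) (y₀ : Vec m)
    (u : ℝ → Vec m) : Prop :=
  u τ₀ = y₀ ∧ ∀ τ, τ₀ ≤ τ → HasDerivWithinAt u (h (x, u τ, τ)) (Ici τ₀) τ

/-- The solution `y(τ, h, x, τ₀, y₀)` of the layer equation, for `τ ≥ τ₀` (meaningful when a
solution on `[τ₀, ∞)` exists; it is then unique if `h` is locally Lipschitz in `y`). -/
noncomputable def layerSol {n m : ℕ} (h : FastField n m) (x : Vec n) (τ₀ : ℝ) (y₀ : Vec m) :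
    ℝ → Vec m :=
  Classical.epsilon (IsLayerSolution h x τ₀ y₀)

/-- Standing assumptions on `f` and `g`: continuity and linear growth in `x` of `f`, admissibility
of `g`, and Lipschitz dependence of `g` on `y`. -/
structure BasicAssumptions {n m : ℕ} (f : Vec n → Vec m → Vec n) (g : FastField n m) : Prop where
  f_continuous : Continuous (fun p : Vec n × Vec m => f p.1 p.2)
  f_growth : ∃ a b : ℝ, 0 < a ∧ 0 < b ∧ ∀ x y, ‖f x y‖ ≤ a + b * ‖x‖
  g_bounded : ∀ K : Set (Vec n × Vec m), IsCompact K →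
    ∃ C : ℝ, ∀ p ∈ K, ∀ τ : ℝ, ‖g (p.1, p.2, τ)‖ ≤ C
  g_uniformContinuous : ∀ K : Set (Vec n × Vec m), IsCompact K →
    UniformContinuousOn (fun q : (Vec n × Vec m) × ℝ => g (q.1.1, q.1.2, q.2)) (K ×ˢ univ)
  g_lipschitz : ∀ (K₀ : Set (Vec n)) (K : Set (Vec m)), IsCompact K₀ → IsCompact K →
    ∃ L : ℝ, ∀ x ∈ K₀, ∀ y₁ ∈ K, ∀ y₂ ∈ K, ∀ τ : ℝ,
      ‖g (x, y₁, τ) - g (x, y₂, τ)‖ ≤ L * ‖y₁ - y₂‖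

/-- The solutions of `y' = g(x, y, τ)`, `x ∈ K₀`, are uniformly ultimately bounded on
`[r₀, ∞)`. -/
def UniformlyUltimatelyBoundedOn {n m : ℕ} (g : FastField n m) (K₀ : Set (Vec n)) (r₀ : ℝ) :
    Prop :=
  ∃ c : ℝ, 0 < c ∧ ∀ d : ℝ, 0 < d → ∃ T : ℝ, 0 ≤ T ∧
    ∀ x ∈ K₀, ∀ τ₀, r₀ ≤ τ₀ → ∀ τ, T ≤ τ → ∀ y₀ : Vec m, ‖y₀‖ ≤ d →
      ‖layerSol g x τ₀ y₀ (τ + τ₀)‖ ≤ c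

/-- Assumptions on the layer equations along the forward orbit and the omega-limit set of `g`:
global forward existence, and uniform ultimate boundedness on `[0, ∞)` over compact sets of
parameters. -/
structure LayerAssumptions {n m : ℕ} (g : FastField n m) [MetricSpace (Hull g)] : Prop where
  forward_existence : ∀ h : Hull g,
    ((∃ τ₀ : ℝ, 0 ≤ τ₀ ∧ h = (Hull.base g).flow τ₀) ∨ h ∈ omegaSet g) →
      ∀ (x : Vec n) (y₀ : Vec m), ∃ u : ℝ → Vec m, IsLayerSolution h.field x 0 y₀ u
  ultimately_bounded : ∀ K₀ : Set (Vec n), IsCompact K₀ → UniformlyUltimatelyBoundedOn g K₀ 0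

/-- The layered semiflow `π_τ(h, x, y₀) = (h·τ, x, y(τ, h, x, y₀))`. -/
noncomputable def layeredSemiflow {n m : ℕ} {g : FastField n m} (τ : ℝ)
    (p : Hull g × Vec n × Vec m) : Hull g × Vec n × Vec m :=
  (p.1.flow τ, p.2.1, layerSol p.1.field p.2.1 0 p.2.2 τ)

/-- The Hausdorff semidistance `sup_{a ∈ S} inf_{b ∈ S'} d(a, b)`, with values in `[0, ∞]`. -/
noncomputable def semidist {X : Type*} [PseudoEMetricSpace X] (S S' : Set X) : ENNReal :=
  ⨆ a ∈ S, Metric.infEDist a S'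

/-- `A` is the global attractor of the layered semiflow on `𝒪(g) × K₀ × ℝᵐ`: compact, invariant,
and attracting `𝒪(g) × K₀ × D` for every bounded `D ⊆ ℝᵐ`. -/
structure IsGlobalAttractor {n m : ℕ} (g : FastField n m) [MetricSpace (Hull g)]
    (K₀ : Set (Vec n)) (A : Set (Hull g × Vec n × Vec m)) : Prop where
  subset : A ⊆ omegaSet g ×ˢ K₀ ×ˢ univ
  isCompact : IsCompact A
  invariant : ∀ τ : ℝ, 0 ≤ τ → layeredSemiflow τ '' A = A
  attracts : ∀ D : Set (Vec m), Bornology.IsBounded D →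
    Tendsto (fun τ : ℝ => semidist (layeredSemiflow τ '' (omegaSet g ×ˢ K₀ ×ˢ D)) A)
      atTop (𝓝 0)

/-- The fiber `A_{(h,x)}`. -/
def fiber {n m : ℕ} {g : FastField n m} (A : Set (Hull g × Vec n × Vec m)) (h : Hull g)
    (x : Vec n) : Set (Vec m) :=
  {y | (h, x, y) ∈ A}

/-- The inflated fiber `B_{(h,x)}[δ]`: the union of the fibers of `A` over those
`(h', x') ∈ 𝒪(g) × K₀` with `d(h', h) ≤ δ` and `|x' - x| ≤ δ`. -/
def inflatedFiber {n m : ℕ} {g : FastField n m} [MetricSpace (Hull g)] (K₀ : Set (Vec n))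
    (A : Set (Hull g × Vec n × Vec m)) (h : Hull g) (x : Vec n) (δ : ℝ) : Set (Vec m) :=
  ⋃ p ∈ {p : Hull g × Vec n | p.1 ∈ omegaSet g ∧ p.2 ∈ K₀ ∧ dist p.1 h ≤ δ ∧ ‖p.2 - x‖ ≤ δ},
    fiber A p.1 p.2

/-- The admissible radii at `(h, x)` for the point `y`: those `δ > 0` with `dist(h, 𝒪(g)) ≤ δ` and
`dist(y, B_{(h,x)}[δ]) ≤ δ`. Distances to sets are `[0, ∞]`-valued, so that the distance to the
empty set is `∞`. -/
def radiusSet {n m : ℕ} {g : FastField n m} [MetricSpace (Hull g)] (K₀ : Set (Vec n))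
    (A : Set (Hull g × Vec n × Vec m)) (h : Hull g) (x : Vec n) (y : Vec m) : Set ℝ :=
  {δ | 0 < δ ∧ Metric.infEDist h (omegaSet g) ≤ ENNReal.ofReal δ ∧
    Metric.infEDist y (inflatedFiber K₀ A h x δ) ≤ ENNReal.ofReal δ}

/-- `(x, y)` solves `ẋ = f(x, y)`, `ε ẏ = g(x, y, t/ε)`, `x(0) = ξ`, `y(0) = η` on `[0, t₀]`
(slow time). -/
structure IsSlowFastSolution {n m : ℕ} (f : Vec n → Vec m → Vec n) (g : FastField n m)
    (ε t₀ : ℝ) (ξ : Vec n) (η : Vec m) (x : ℝ → Vec n) (y : ℝ → Vec m) : Prop where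
  x_init : x 0 = ξ
  y_init : y 0 = η
  x_deriv : ∀ t ∈ Icc 0 t₀, HasDerivWithinAt x (f (x t) (y t)) (Icc 0 t₀) t
  y_deriv : ∀ t ∈ Icc 0 t₀,
    HasDerivWithinAt y (ε⁻¹ • g (x t, y t, t / ε)) (Icc 0 t₀) t

/-- A function of the slow time `t`, written in the fast time `τ = t/ε`. -/
def inFastTime {m : ℕ} (ε : ℝ) (y : ℝ → Vec m) (τ : ℝ) : Vec m := y (ε * τ)

/-- The closed tube `{x(t) + v | t ∈ [0, t₀], |v| ≤ r}`. -/
def tube {n : ℕ} (x : ℝ → Vec n) (t₀ r : ℝ) : Set (Vec n) :=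
  {z | ∃ t ∈ Icc 0 t₀, ∃ v : Vec n, ‖v‖ ≤ r ∧ z = x t + v}

end SlowFast

open SlowFast

/-! In the fast time `τ = t/ε` the fast component solves the layer equation with a slowly drifting
parameter, and over a window of fixed fast length the drift vanishes as `ε → 0`. A window ending at
`t₀/ε` therefore looks in the limit like an exact layer solution over the omega-limit set.

The translates of `g` are equicontinuous, so the hull is compact, and a Gronwall-type barrier
(`norm_sub_le_of_approx_solution`, `tendstoUniformlyOn_solution`) makes layer solutions depend
continuously on field, parameter and initial value. Hence the ultimate bound passes from the orbit
of `g` to its omega-limit set (`exists_absorbing_bound`), and the attractor is the intersection of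
the forward images of a compact invariant set (`exists_attractor`).

Comparing window by window with frozen layer solutions bounds the fast components uniformly
(`exists_eventually_norm_le`). Take an ultrafilter limit `p` of the end states. For each `S`, the
states `S` units earlier also converge, so `p` is the time-`S` image of a point with fast component
in one fixed ball; attraction forces `p` into the attractor (`exists_tendsto_mem_attractor`). The
conclusions about `δ` and the fibers are then read off along ultrafilters. -/

namespace SlowFast

variable {n m : ℕ}

/-! ### Compactness of the hull and continuity of the shift flow -/

@[simp]
theorem shift_apply (s : ℝ) (h : FastField n m) (p : Vec n × Vec m × ℝ) :
    shift s h p = h (p.1, p.2.1, p.2.2 + s) := rfl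

/-- `h` is Lipschitz in `y`, locally uniformly in `x` and uniformly in `τ`. -/
def LipschitzInFast (h : FastField n m) : Prop :=
  ∀ (K₀ : Set (Vec n)) (K : Set (Vec m)), IsCompact K₀ → IsCompact K →
    ∃ L : ℝ, ∀ x ∈ K₀, ∀ y₁ ∈ K, ∀ y₂ ∈ K, ∀ τ : ℝ,
      ‖h (x, y₁, τ) - h (x, y₂, τ)‖ ≤ L * ‖y₁ - y₂‖

/-- For fixed points the estimate is a closed condition on the field and holds for every translate
of `g`, so the same `L` survives in the closure. -/
theorem Hull.lipschitzInFast {g : FastField n m} (hg : LipschitzInFast g) (h : Hull g) :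
    LipschitzInFast h.field := by
  intro K₀ K hK₀ hK
  obtain ⟨L, hL⟩ := hg K₀ K hK₀ hK
  refine ⟨L, fun x hx y₁ h₁ y₂ h₂ τ => ?_⟩
  have hcl : IsClosed {w : FastField n m |
      ‖w (x, y₁, τ) - w (x, y₂, τ)‖ ≤ L * ‖y₁ - y₂‖} :=
    isClosed_le (by fun_prop) continuous_const
  have hsub : range (fun s : ℝ => shift s g) ⊆ {w : FastField n m |
      ‖w (x, y₁, τ) - w (x, y₂, τ)‖ ≤ L * ‖y₁ - y₂‖} := by
    rintro _ ⟨s, rfl⟩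
    exact hL x hx y₁ h₁ y₂ h₂ (τ + s)
  exact closure_minimal hsub hcl (Subtype.property h)

/-- Arzelà–Ascoli: uniform continuity on `K × ℝ` does not see the time shift, which gives
equicontinuity of the translates, and boundedness gives pointwise relative compactness. -/
theorem isCompact_closure_range_shift {f : Vec n → Vec m → Vec n} {g : FastField n m}
    (hfg : BasicAssumptions f g) : IsCompact (closure (range fun s : ℝ => shift s g)) := by
  have : T2Space (UniformOnFun (Vec n × Vec m × ℝ) (Vec m) {K | IsCompact K}) :=
    UniformOnFun.t2Space_of_covering
      (eq_univ_iff_forall.2 fun p => mem_sUnion_of_mem (mem_singleton p) isCompact_singleton)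
  refine ArzelaAscoli.isCompact_closure_of_isClosedEmbedding
    (𝔖 := {K : Set (Vec n × Vec m × ℝ) | IsCompact K}) (F := fun h : FastField n m => ⇑h)
    (fun K hK => hK)
    (ContinuousMap.isUniformEmbedding_toUniformOnFunIsCompact.isClosedEmbedding) ?_ ?_
  · intro K _
    refine Equicontinuous.equicontinuousOn (fun p => ?_) K
    rw [Metric.equicontinuousAt_iff]
    intro e he
    have hK' : IsCompact (Metric.closedBall p.1 1 ×ˢ Metric.closedBall p.2.1 1) :=
      (isCompact_closedBall _ _).prod (isCompact_closedBall _ _)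
    obtain ⟨δ, hδ, H⟩ := Metric.uniformContinuousOn_iff.1 (hfg.g_uniformContinuous _ hK') e he
    refine ⟨min δ 1, by positivity, fun q hq i => ?_⟩
    obtain ⟨_, s, rfl⟩ := i
    have h1 := hq.trans_le (min_le_left _ _)
    have h2 := (hq.trans_le (min_le_right _ _)).le
    simp only [Prod.dist_eq, max_lt_iff, max_le_iff] at h1 h2
    refine H ((p.1, p.2.1), p.2.2 + s) (by simp) ((q.1, q.2.1), q.2.2 + s) (by simp [h2]) ?_
    rw [dist_comm]
    simp [Prod.dist_eq, h1]
  · intro K _ p _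
    obtain ⟨C, hC⟩ := hfg.g_bounded {(p.1, p.2.1)} isCompact_singleton
    refine ⟨Metric.closedBall 0 C, isCompact_closedBall _ _, ?_⟩
    rintro _ ⟨s, rfl⟩
    simpa using hC _ rfl (p.2.2 + s)

theorem continuous_shift_uncurry :
    Continuous (fun p : ℝ × FastField n m => shift p.1 p.2) := by
  refine ContinuousMap.continuous_of_continuous_uncurry _ ?_
  simp only [Function.uncurry_def, shift_apply]
  fun_prop

namespace Hull

variable {g : FastField n m}

theorem field_injective : Function.Injective (Hull.field : Hull g → FastField n m) :=
  fun _ _ h => Subtype.ext h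

@[simp]
theorem field_flow (τ : ℝ) (h : Hull g) : (h.flow τ).field = shift τ h.field := rfl

@[simp]
theorem field_base : (Hull.base g).field = g := rfl

theorem flow_flow (s r : ℝ) (h : Hull g) : (h.flow r).flow s = h.flow (s + r) :=
  field_injective (shift_shift s r h.field)

@[simp]
theorem flow_zero (h : Hull g) : h.flow 0 = h :=
  field_injective (by ext p; simp)

variable [MetricSpace (Hull g)]

theorem compactSpace (hd : IsHullMetric g) {f : Vec n → Vec m → Vec n}
    (hfg : BasicAssumptions f g) : CompactSpace (Hull g) := by
  rw [← isCompact_univ_iff, hd.isInducing.isCompact_iff]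
  convert isCompact_closure_range_shift hfg
  ext h
  simp only [image_univ, mem_range]
  exact ⟨fun ⟨a, ha⟩ => ha ▸ Subtype.property a, fun hh => ⟨⟨h, hh⟩, rfl⟩⟩

theorem continuous_flow (hd : IsHullMetric g) :
    Continuous (fun p : ℝ × Hull g => p.2.flow p.1) := by
  rw [hd.isInducing.continuous_iff]
  exact continuous_shift_uncurry.comp
    (continuous_fst.prodMk (hd.continuous.comp continuous_snd))

end Hull

/-! ### The omega-limit set and the forward hull -/

section OmegaLimit

variable {g : FastField n m} [MetricSpace (Hull g)]

theorem isClosed_omegaSet : IsClosed (omegaSet g) := isClosed_omegaLimit _ _ _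

theorem mem_omegaSet_of_tendsto {ι : Type*} {l : Filter ι} [l.NeBot] {s : ι → ℝ}
    (hs : Tendsto s l atTop) {h : Hull g}
    (hh : Tendsto (fun i => (Hull.base g).flow (s i)) l (𝓝 h)) : h ∈ omegaSet g := by
  rw [omegaSet, mem_omegaLimit_singleton_iff_mapClusterPt]
  exact (hh.mapClusterPt).of_comp hs

theorem flow_mem_omegaSet (hd : IsHullMetric g) {h : Hull g} (hh : h ∈ omegaSet g) (τ : ℝ) :
    h.flow τ ∈ omegaSet g := by
  have hc : Continuous (fun h : Hull g => h.flow τ) :=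
    (Hull.continuous_flow hd).comp (continuous_const.prodMk continuous_id)
  rw [omegaSet, mem_omegaLimit_singleton_iff_mapClusterPt] at *
  refine MapClusterPt.of_comp (φ := fun t => τ + t) (p := atTop)
    (tendsto_atTop_add_const_left _ τ tendsto_id) ?_
  have := hh.continuousAt_comp hc.continuousAt
  simpa [Function.comp_def, Hull.flow_flow] using this

/-- The forward orbit of `g` together with its omega-limit set. -/
def forwardHull (g : FastField n m) [MetricSpace (Hull g)] : Set (Hull g) :=
  (fun τ : ℝ => (Hull.base g).flow τ) '' Ici 0 ∪ omegaSet g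

/-- A point off the omega-limit set avoids the closure of some tail of the orbit; the rest of the
orbit is a compact arc. -/
theorem isClosed_forwardHull (hd : IsHullMetric g) : IsClosed (forwardHull g) := by
  refine isClosed_of_closure_subset fun h hh => ?_
  by_cases hO : h ∈ omegaSet g
  · exact Or.inr hO
  have hc : Continuous (fun τ : ℝ => (Hull.base g).flow τ) :=
    (Hull.continuous_flow hd).comp (continuous_id.prodMk continuous_const)
  have hO' := hO
  simp only [omegaSet, omegaLimit_def, mem_iInter, not_forall] at hO'
  obtain ⟨u, hu, hhu⟩ := hO'
  obtain ⟨T, hT⟩ := mem_atTop_sets.1 hu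
  have hcover : forwardHull g ⊆ (fun τ : ℝ => (Hull.base g).flow τ) '' Icc 0 T ∪
      closure (image2 (fun (τ : ℝ) (h : Hull g) => h.flow τ) u {Hull.base g}) := by
    rintro _ (⟨τ, hτ, rfl⟩ | hk)
    · rcases le_total τ T with h1 | h1
      · exact Or.inl ⟨τ, ⟨hτ, h1⟩, rfl⟩
      · exact Or.inr (subset_closure ⟨τ, hT τ h1, _, rfl, rfl⟩)
    · exact Or.inr (omegaLimit_subset_closure_image2 _ _ _ hu hk)
  have hcl : IsClosed ((fun τ : ℝ => (Hull.base g).flow τ) '' Icc 0 T ∪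
      closure (image2 (fun (τ : ℝ) (h : Hull g) => h.flow τ) u {Hull.base g})) :=
    (isCompact_Icc.image hc).isClosed.union isClosed_closure
  rcases closure_minimal hcover hcl hh with ⟨τ, hτ, h1⟩ | h1
  · exact Or.inl ⟨τ, hτ.1, h1⟩
  · exact absurd h1 hhu

theorem flow_mem_forwardHull (hd : IsHullMetric g) {h : Hull g} (hh : h ∈ forwardHull g) {τ : ℝ}
    (hτ : 0 ≤ τ) : h.flow τ ∈ forwardHull g := by
  rcases hh with ⟨s, hs, rfl⟩ | hh
  · exact Or.inl ⟨τ + s, add_nonneg hτ hs, (Hull.flow_flow _ _ _).symm⟩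
  · exact Or.inr (flow_mem_omegaSet hd hh τ)

end OmegaLimit

/-! ### Comparison of solutions and continuous dependence -/

/-- A solution `u` of `u' = v(s, u)` and an approximate solution `Z` that starts close to it stay
close. The estimates on the vector field are only needed within distance `β` of `u`. -/
theorem norm_sub_le_of_approx_solution {E : Type*} [NormedAddCommGroup E] [NormedSpace ℝ E]
    {v : ℝ → E → E} {u Z Z' : ℝ → E} {a b L α β : ℝ} (hα : 0 < α)
    (hu : ContinuousOn u (Icc a b))
    (hu' : ∀ s ∈ Ico a b, HasDerivWithinAt u (v s (u s)) (Ici s) s)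
    (hZ : ContinuousOn Z (Icc a b))
    (hZ' : ∀ s ∈ Ico a b, HasDerivWithinAt Z (Z' s) (Ici s) s)
    (hL : 0 ≤ L)
    (hLip : ∀ s ∈ Ico a b, ∀ w, ‖w - u s‖ ≤ β → ‖v s w - v s (u s)‖ ≤ L * ‖w - u s‖)
    (happrox : ∀ s ∈ Ico a b, ‖Z s - u s‖ ≤ β → ‖Z' s - v s (Z s)‖ < α)
    (hαβ : α * Real.exp ((L + 1) * (b - a)) ≤ β) (h0 : ‖Z a - u a‖ ≤ α) :
    ∀ s ∈ Icc a b, ‖Z s - u s‖ ≤ α * Real.exp ((L + 1) * (s - a)) := by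
  -- Barrier `B = α e^{(L+1)(s-a)}`: where the error equals `B`, its growth rate is below `α + L B ≤
  -- (L+1) B = B'`, since `B ≥ α`. There `B ≤ β`, so the local hypotheses suffice.
  have key := image_norm_le_of_norm_deriv_right_lt_deriv_boundary
    (f := fun s => Z s - u s) (f' := fun s => Z' s - v s (u s)) (a := a) (b := b)
    (B := fun s => α * Real.exp ((L + 1) * (s - a)))
    (B' := fun s => α * (Real.exp ((L + 1) * (s - a)) * (L + 1))) (hZ.sub hu)
    (fun s hs => (hZ' s hs).sub (hu' s hs)) (by simpa using h0) ?_ ?_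
  · exact fun s hs => key hs
  · intro s
    have h1 : HasDerivAt (fun s : ℝ => (L + 1) * (s - a)) (L + 1) s := by
      simpa using ((hasDerivAt_id s).sub_const a).const_mul (L + 1)
    exact h1.exp.const_mul α
  · intro s hs hB
    have hexp : 1 ≤ Real.exp ((L + 1) * (s - a)) :=
      Real.one_le_exp (mul_nonneg (by linarith) (by linarith [hs.1]))
    have hle : ‖Z s - u s‖ ≤ β := by
      rw [hB]
      refine le_trans ?_ hαβ
      have := hs.2.le
      gcongr
    have h1 : ‖Z' s - v s (u s)‖ ≤ ‖Z' s - v s (Z s)‖ + ‖v s (Z s) - v s (u s)‖ :=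
      norm_sub_le_norm_sub_add_norm_sub _ _ _
    have h2 := happrox s hs hle
    have h3 := hLip s hs _ hle
    rw [hB] at h3
    nlinarith [mul_le_mul_of_nonneg_left hexp hα.le]

/-- `Z` solves `Z' = h(ξ(s), Z, s)` on `[a, b]`, with a varying parameter `ξ`. -/
structure SolvesOn (h : FastField n m) (ξ : ℝ → Vec n) (a b : ℝ) (Z : ℝ → Vec m) : Prop where
  continuousOn : ContinuousOn Z (Icc a b)
  deriv : ∀ s ∈ Ico a b, HasDerivWithinAt Z (h (ξ s, Z s, s)) (Ici s) s

theorem IsLayerSolution.solvesOn {h : FastField n m} {x : Vec n} {τ₀ : ℝ} {y₀ : Vec m}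
    {u : ℝ → Vec m} (hu : IsLayerSolution h x τ₀ y₀ u) {a : ℝ} (ha : τ₀ ≤ a) (b : ℝ) :
    SolvesOn h (fun _ => x) a b u where
  continuousOn s hs := (hu.2 s (ha.trans hs.1)).continuousWithinAt.mono
    fun _ ht => ha.trans ht.1
  deriv s hs := (hu.2 s (ha.trans hs.1)).mono (Ici_subset_Ici.2 (ha.trans hs.1))

theorem SolvesOn.comp_add {h : FastField n m} {ξ : ℝ → Vec n} {a b : ℝ} {Z : ℝ → Vec m}
    (hZ : SolvesOn h ξ a b Z) (c : ℝ) :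
    SolvesOn (shift c h) (fun s => ξ (s + c)) (a - c) (b - c) (fun s => Z (s + c)) where
  continuousOn := hZ.continuousOn.comp (by fun_prop)
    fun s hs => ⟨by linarith [hs.1], by linarith [hs.2]⟩
  deriv s hs := by
    have h1 := hZ.deriv (s + c) ⟨by linarith [hs.1], by linarith [hs.2]⟩
    have h2 : HasDerivWithinAt (fun s : ℝ => s + c) 1 (Ici s) s :=
      (hasDerivWithinAt_id s _).add_const c
    simpa [Function.comp_def] using h1.scomp s h2 (fun t ht => add_le_add_left ht c)

theorem IsLayerSolution.comp_add {h : FastField n m} {x : Vec n} {τ₀ : ℝ} {y₀ : Vec m}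
    {u : ℝ → Vec m} (hu : IsLayerSolution h x τ₀ y₀ u) (c a : ℝ) (ha : τ₀ ≤ a + c) :
    IsLayerSolution (shift c h) x a (u (a + c)) (fun s => u (s + c)) := by
  refine ⟨rfl, fun s hs => ?_⟩
  have h1 := hu.2 (s + c) (by linarith)
  have h2 : HasDerivWithinAt (fun s : ℝ => s + c) 1 (Ici a) s :=
    (hasDerivWithinAt_id s _).add_const c
  simpa [Function.comp_def] using
    h1.scomp s h2 (fun t ht => ha.trans (add_le_add_left ht c))

/-- Continuous dependence of solutions on the field, the parameter and the initial value; no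
a priori bound on the approximating solutions is needed. -/
theorem tendstoUniformlyOn_solution {ι : Type*} {l : Filter ι} {hk : ι → FastField n m}
    {h : FastField n m} (hh : Tendsto hk l (𝓝 h)) (hLip : LipschitzInFast h) {S : ℝ}
    {ξ : ι → ℝ → Vec n} {x : Vec n} (hξ : TendstoUniformlyOn ξ (fun _ => x) l (Icc 0 S))
    {Z : ι → ℝ → Vec m} {u : ℝ → Vec m} (hZ : ∀ᶠ k in l, SolvesOn (hk k) (ξ k) 0 S (Z k))
    (hu : SolvesOn h (fun _ => x) 0 S u) (h0 : Tendsto (fun k => Z k 0) l (𝓝 (u 0))) :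
    TendstoUniformlyOn Z u l (Icc 0 S) := by
  obtain ⟨M, hM⟩ := isCompact_Icc.exists_bound_of_continuousOn hu.continuousOn
  have hK : IsCompact (Metric.closedBall (0 : Vec m) (M + 1)) := isCompact_closedBall _ _
  obtain ⟨L, hL⟩ := hLip {x} _ isCompact_singleton hK
  have hmem : ∀ s ∈ Icc 0 S, ∀ w, ‖w - u s‖ ≤ 1 → w ∈ Metric.closedBall (0 : Vec m) (M + 1) := by
    intro s hs w hw
    have h1 := norm_sub_norm_le w (u s)
    have h2 := hM s hs
    simp only [Metric.mem_closedBall, dist_zero_right]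
    linarith
  rw [Metric.tendstoUniformlyOn_iff]
  intro e he
  set β := min e 1 / 2
  have hβ : 0 < β := by positivity
  have hβ1 : β ≤ 1 := by
    have := min_le_right e 1
    simp only [β]; linarith
  have hβe : β < e := by
    have := min_le_left e 1
    simp only [β]; linarith
  -- Chosen so that the barrier grows from `α` to exactly `β` on `[0, S]`.
  set α := β * Real.exp (-((max L 0 + 1) * (S - 0)))
  have hα : 0 < α := by positivity
  have hαβ : α * Real.exp ((max L 0 + 1) * (S - 0)) = β := by
    simp only [α]; rw [mul_assoc, ← Real.exp_add]; simp
  set Q : Set (Vec n × Vec m × ℝ) :=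
    Metric.closedBall x 1 ×ˢ Metric.closedBall (0 : Vec m) (M + 1) ×ˢ Icc 0 S
  have hQ : IsCompact Q := (isCompact_closedBall _ _).prod (hK.prod isCompact_Icc)
  obtain ⟨δ, hδ, hunif⟩ := Metric.uniformContinuousOn_iff.1
    (hQ.uniformContinuousOn_of_continuous h.continuous.continuousOn) (α / 2) (by positivity)
  have hconv := Metric.tendstoUniformlyOn_iff.1
    (ContinuousMap.tendsto_iff_forall_isCompact_tendstoUniformlyOn.1 hh Q hQ) (α / 2)
    (by positivity)
  filter_upwards [hZ, hconv, Metric.tendstoUniformlyOn_iff.1 hξ (min δ 1) (by positivity),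
    Metric.tendsto_nhds.1 h0 α hα] with k hZk hck hξk h0k s hs
  have hb := norm_sub_le_of_approx_solution (v := fun s w => h (x, w, s)) (u := u) (Z := Z k)
    (β := β) hα hu.continuousOn hu.deriv hZk.continuousOn hZk.deriv (le_max_right L 0)
    (fun t ht w hw => ?_) (fun t ht hw => ?_) hαβ.le (by simpa [dist_eq_norm] using h0k.le) s hs
  · rw [dist_comm, dist_eq_norm]
    refine (hb.trans ?_).trans_lt hβe
    rw [← hαβ]
    have := hs.2
    gcongr
  · have ht' := Ico_subset_Icc_self ht
    refine (hL x rfl w (hmem t ht' w (hw.trans hβ1)) (u t)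
      (hmem t ht' _ (by simp)) t).trans ?_
    gcongr
    exact le_max_left _ _
  · have ht' := Ico_subset_Icc_self ht
    have hw' := hmem t ht' _ (hw.trans hβ1)
    have hx := hξk t ht'
    rw [dist_comm] at hx
    have h1Q : (ξ k t, Z k t, t) ∈ Q := ⟨(hx.trans_le (min_le_right _ _)).le, hw', ht'⟩
    have h2Q : (x, Z k t, t) ∈ Q := ⟨by simp, hw', ht'⟩
    have e1 := hck _ h1Q
    have e2 := hunif _ h1Q _ h2Q (by simpa [Prod.dist_eq, hδ] using hx.trans_le (min_le_left _ _))
    rw [dist_comm] at e1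
    rw [← dist_eq_norm]
    calc dist (hk k (ξ k t, Z k t, t)) (h (x, Z k t, t)) ≤ _ := dist_triangle _ _ _
      _ < α / 2 + α / 2 := add_lt_add e1 e2
      _ = α := add_halves α

/-- Uniqueness is continuous dependence for a constant sequence: `w` converges to `u`. -/
theorem eqOn_of_solvesOn {h : FastField n m} (hLip : LipschitzInFast h) {S : ℝ} {x : Vec n}
    {u w : ℝ → Vec m} (hu : SolvesOn h (fun _ => x) 0 S u) (hw : SolvesOn h (fun _ => x) 0 S w)
    (h0 : w 0 = u 0) : EqOn w u (Icc 0 S) := by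
  intro s hs
  have h1 : TendstoUniformlyOn (fun (_ : ℕ) (_ : ℝ) => x) (fun _ => x) atTop (Icc 0 S) :=
    Metric.tendstoUniformlyOn_iff.2 fun e he => by simp [he]
  have h2 := tendstoUniformlyOn_solution (l := (atTop : Filter ℕ)) (hk := fun _ => h)
    tendsto_const_nhds hLip h1 (Z := fun _ => w) (Eventually.of_forall fun _ => hw) hu
    (by simp [h0])
  exact tendsto_nhds_unique tendsto_const_nhds (h2.tendsto_at hs)

theorem BasicAssumptions.lipschitzInFast {f : Vec n → Vec m → Vec n} {g : FastField n m}
    (hfg : BasicAssumptions f g) : LipschitzInFast g := hfg.g_lipschitz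

/-! ### Layer solutions over the forward hull -/

section Layer

variable {g : FastField n m} [MetricSpace (Hull g)]

theorem LayerAssumptions.isLayerSolution (hlayer : LayerAssumptions g) {h : Hull g}
    (hh : h ∈ forwardHull g) (x : Vec n) (y₀ : Vec m) :
    IsLayerSolution h.field x 0 y₀ (layerSol h.field x 0 y₀) := by
  refine Classical.epsilon_spec (hlayer.forward_existence h ?_ x y₀)
  rcases hh with ⟨s, hs, rfl⟩ | hh
  · exact Or.inl ⟨s, hs, rfl⟩
  · exact Or.inr hh

theorem LayerAssumptions.isLayerSolution_base (hlayer : LayerAssumptions g) (x : Vec n)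
    {τ₀ : ℝ} (hτ₀ : 0 ≤ τ₀) (y₀ : Vec m) : IsLayerSolution g x τ₀ y₀ (layerSol g x τ₀ y₀) := by
  refine Classical.epsilon_spec (p := IsLayerSolution g x τ₀ y₀) ?_
  obtain ⟨u, hu⟩ := hlayer.forward_existence ((Hull.base g).flow τ₀) (Or.inl ⟨τ₀, hτ₀, rfl⟩) x y₀
  have h1 := hu.comp_add (-τ₀) τ₀ (by simp)
  simp only [Hull.field_flow, Hull.field_base, shift_shift, neg_add_cancel, add_neg_cancel,
    hu.1] at h1
  exact ⟨_, by rwa [show shift 0 g = g by ext p; simp] at h1⟩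

/-- Converts starting times into translates, so that the ultimate bound assumed for `g` becomes one
along its forward orbit. -/
theorem layerSol_base_add (hg : LipschitzInFast g) (hlayer : LayerAssumptions g) (x : Vec n)
    {τ₀ : ℝ} (hτ₀ : 0 ≤ τ₀) (y₀ : Vec m) {τ : ℝ} (hτ : 0 ≤ τ) :
    layerSol g x τ₀ y₀ (τ + τ₀) = layerSol ((Hull.base g).flow τ₀).field x 0 y₀ τ := by
  have h1 := hlayer.isLayerSolution (h := (Hull.base g).flow τ₀) (Or.inl ⟨τ₀, hτ₀, rfl⟩) x y₀
  have h0 := hlayer.isLayerSolution_base x hτ₀ y₀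
  have h2 := h0.comp_add τ₀ 0 (by simp)
  refine eqOn_of_solvesOn (Hull.lipschitzInFast hg _) (h1.solvesOn le_rfl τ)
    (h2.solvesOn le_rfl τ) ?_ ⟨hτ, le_rfl⟩
  rw [h1.1]
  simp [h0.1]

theorem layerSol_add (hd : IsHullMetric g) (hg : LipschitzInFast g) (hlayer : LayerAssumptions g)
    {h : Hull g} (hh : h ∈ forwardHull g) (x : Vec n) (y₀ : Vec m) {s t : ℝ} (hs : 0 ≤ s)
    (ht : 0 ≤ t) :
    layerSol h.field x 0 y₀ (t + s) =
      layerSol (h.flow s).field x 0 (layerSol h.field x 0 y₀ s) t := by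
  have h0 := hlayer.isLayerSolution hh x y₀
  have h1 := hlayer.isLayerSolution (flow_mem_forwardHull hd hh hs) x (layerSol h.field x 0 y₀ s)
  have h2 := h0.comp_add s 0 (by simpa using hs)
  refine eqOn_of_solvesOn (Hull.lipschitzInFast hg _) (h1.solvesOn le_rfl t)
    (h2.solvesOn le_rfl t) ?_ ⟨ht, le_rfl⟩
  rw [h1.1]
  simp

theorem tendstoUniformlyOn_layerSol (hd : IsHullMetric g) (hg : LipschitzInFast g)
    (hlayer : LayerAssumptions g) {h : Hull g} (hh : h ∈ forwardHull g) (x : Vec n) (y₀ : Vec m)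
    (S : ℝ) :
    TendstoUniformlyOn (fun (p : Hull g × Vec n × Vec m) => layerSol p.1.field p.2.1 0 p.2.2)
      (layerSol h.field x 0 y₀) (𝓝[forwardHull g ×ˢ univ] (h, x, y₀)) (Icc 0 S) := by
  have hle : 𝓝[forwardHull g ×ˢ (univ : Set (Vec n × Vec m))] (h, x, y₀) ≤ 𝓝 (h, x, y₀) :=
    nhdsWithin_le_nhds
  have hu := hlayer.isLayerSolution hh x y₀
  refine tendstoUniformlyOn_solution
    (hk := fun p : Hull g × Vec n × Vec m => p.1.field) (ξ := fun p _ => p.2.1) (x := x)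
    ?_ (Hull.lipschitzInFast hg h) ?_ ?_ (hu.solvesOn le_rfl S) ?_
  · exact ((hd.continuous.comp continuous_fst).tendsto (h, x, y₀)).mono_left hle
  · rw [Metric.tendstoUniformlyOn_iff]
    intro e he
    have h1 : Tendsto (fun p : Hull g × Vec n × Vec m => p.2.1) (𝓝 (h, x, y₀)) (𝓝 x) :=
      Continuous.tendsto (by fun_prop) (h, x, y₀)
    filter_upwards [hle (Metric.tendsto_nhds.1 h1 e he)] with p hp s _
    rwa [dist_comm]
  · filter_upwards [self_mem_nhdsWithin] with p hp
    exact (hlayer.isLayerSolution hp.1 _ _).solvesOn le_rfl S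
  · have h1 : Tendsto (fun p : Hull g × Vec n × Vec m => p.2.2) (𝓝 (h, x, y₀)) (𝓝 y₀) :=
      Continuous.tendsto (by fun_prop) (h, x, y₀)
    rw [hu.1]
    refine (h1.mono_left hle).congr' ?_
    filter_upwards [self_mem_nhdsWithin] with p hp
    exact (hlayer.isLayerSolution hp.1 _ _).1.symm

/-- Uniform convergence on `[0, s + 1]`, which leaves room to the right of `s`, combined with
continuity in time of the limiting solution. -/
theorem continuousOn_layerSol (hd : IsHullMetric g) (hg : LipschitzInFast g)
    (hlayer : LayerAssumptions g) :
    ContinuousOn (fun q : ℝ × Hull g × Vec n × Vec m => layerSol q.2.1.field q.2.2.1 0 q.2.2.2 q.1)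
      (Ici 0 ×ˢ forwardHull g ×ˢ univ) := by
  rintro ⟨s, h, x, y₀⟩ ⟨hs, hh, -⟩
  simp only [mem_Ici] at hs hh
  have hu := (hlayer.isLayerSolution hh x y₀).solvesOn le_rfl (s + 1)
  have hunif := Metric.tendstoUniformlyOn_iff.1
    (tendstoUniformlyOn_layerSol hd hg hlayer hh x y₀ (s + 1))
  rw [Metric.continuousWithinAt_iff']
  intro e he
  rw [nhdsWithin_prod_eq]
  have h1 := Metric.continuousWithinAt_iff'.1 ((hlayer.isLayerSolution hh x y₀).2 s
    hs).continuousWithinAt (e / 2) (by positivity)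
  have h2 : ∀ᶠ t in 𝓝[Ici 0] s, t ∈ Icc 0 (s + 1) := by
    filter_upwards [self_mem_nhdsWithin,
      nhdsWithin_le_nhds (Iic_mem_nhds (lt_add_one s))] with t h1 h2
    exact ⟨h1, h2⟩
  filter_upwards [((h1.and h2).prod_mk (hunif (e / 2) (by positivity)))]
  rintro ⟨t, p⟩ ⟨⟨ht1, ht2⟩, hp⟩
  have h3 := hp t ht2
  rw [dist_comm] at h3
  calc _ ≤ _ := dist_triangle _ _ _
    _ < e / 2 + e / 2 := add_lt_add h3 ht1
    _ = e := add_halves e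

theorem continuousOn_layeredSemiflow (hd : IsHullMetric g) (hg : LipschitzInFast g)
    (hlayer : LayerAssumptions g) :
    ContinuousOn (fun q : ℝ × Hull g × Vec n × Vec m => layeredSemiflow q.1 q.2)
      (Ici 0 ×ˢ forwardHull g ×ˢ univ) := by
  refine ContinuousOn.prodMk ?_ (ContinuousOn.prodMk (by fun_prop)
    (continuousOn_layerSol hd hg hlayer))
  exact ((Hull.continuous_flow hd).comp
    (continuous_fst.prodMk (continuous_fst.comp continuous_snd))).continuousOn

/-- Solutions of the layer equations starting in a bounded set are bounded on bounded time
intervals, uniformly along the forward hull. -/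
theorem exists_bound_layerSol [CompactSpace (Hull g)] (hd : IsHullMetric g)
    (hg : LipschitzInFast g) (hlayer : LayerAssumptions g) {K₀ : Set (Vec n)} (hK₀ : IsCompact K₀)
    (ρ T : ℝ) :
    ∃ R : ℝ, ∀ h ∈ forwardHull g, ∀ x ∈ K₀, ∀ y₀ : Vec m, ‖y₀‖ ≤ ρ → ∀ τ ∈ Icc 0 T,
      ‖layerSol h.field x 0 y₀ τ‖ ≤ R := by
  have hcomp : IsCompact (Icc (0 : ℝ) T ×ˢ forwardHull g ×ˢ K₀ ×ˢ Metric.closedBall (0 : Vec m) ρ) :=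
    isCompact_Icc.prod ((isClosed_forwardHull hd).isCompact.prod
      (hK₀.prod (isCompact_closedBall _ _)))
  obtain ⟨R, hR⟩ := hcomp.exists_bound_of_continuousOn
    ((continuousOn_layerSol hd hg hlayer).mono (prod_mono Icc_subset_Ici_self
      (prod_mono Subset.rfl (subset_univ _))))
  exact ⟨R, fun h hh x hx y₀ hy τ hτ => hR (τ, h, x, y₀) ⟨hτ, hh, hx, by simpa using hy⟩⟩

/-- Uniform ultimate boundedness along the forward orbit passes to the omega-limit set. -/
theorem exists_absorbing_bound (hd : IsHullMetric g) (hg : LipschitzInFast g)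
    (hlayer : LayerAssumptions g) {K₀ : Set (Vec n)} (hK₀ : IsCompact K₀) :
    ∃ c : ℝ, 0 < c ∧ ∀ ρ : ℝ, ∃ T : ℝ, 0 ≤ T ∧ ∀ h ∈ forwardHull g, ∀ x ∈ K₀, ∀ τ, T ≤ τ →
      ∀ y₀ : Vec m, ‖y₀‖ ≤ ρ → ‖layerSol h.field x 0 y₀ τ‖ ≤ c := by
  obtain ⟨c, hc, H⟩ := hlayer.ultimately_bounded K₀ hK₀
  refine ⟨c, hc, fun ρ => ?_⟩
  obtain ⟨T, hT, HT⟩ := H (max ρ 1) (by positivity)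
  have horb : ∀ s, 0 ≤ s → ∀ x ∈ K₀, ∀ τ, T ≤ τ → ∀ y₀ : Vec m, ‖y₀‖ ≤ ρ →
      ‖layerSol ((Hull.base g).flow s).field x 0 y₀ τ‖ ≤ c := by
    intro s hs x hx τ hτ y₀ hy
    rw [← layerSol_base_add hg hlayer x hs y₀ (hT.trans hτ)]
    exact HT x hx s hs τ hτ y₀ (hy.trans (le_max_left _ _))
  refine ⟨T, hT, fun h hh x hx τ hτ y₀ hy => ?_⟩
  rcases hh with ⟨s, hs, rfl⟩ | hh
  · exact horb s hs x hx τ hτ y₀ hy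
  · have hh' := hh
    rw [omegaSet, mem_omegaLimit_singleton_iff_mapClusterPt, mapClusterPt_iff_ultrafilter] at hh'
    -- Along `U` the translates of `g` tend to `h`, and at fixed `τ` the bound `c` is a closed
    -- condition.
    obtain ⟨U, hU, hlim⟩ := hh'
    have hpos : ∀ᶠ s in (U : Filter ℝ), (0 : ℝ) ≤ s := hU (eventually_ge_atTop 0)
    have h1 : Tendsto (fun s : ℝ => ((Hull.base g).flow s, x, y₀)) U
        (𝓝[forwardHull g ×ˢ univ] (h, x, y₀)) := by
      refine tendsto_nhdsWithin_iff.2 ⟨hlim.prodMk_nhds tendsto_const_nhds, ?_⟩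
      filter_upwards [hpos] with s hs
      exact ⟨Or.inl ⟨s, hs, rfl⟩, trivial⟩
    have h2 := ((tendstoUniformlyOn_layerSol hd hg hlayer (Or.inr hh) x y₀ τ).tendsto_at
      (⟨hT.trans hτ, le_rfl⟩ : τ ∈ Icc 0 τ)).comp h1
    refine le_of_tendsto h2.norm ?_
    filter_upwards [hpos] with s hs
    exact horb s hs x hx τ hτ y₀ hy

end Layer

/-! ### Attractors of abstract semiflows -/

/-- A semiflow, continuous on a forward invariant set `E` of a metric space, with a compact set
`B ⊆ E` absorbing a family `𝒞` of sets that contains `B`, has a compact invariant set that attracts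
the family. -/
theorem exists_attractor {X : Type*} [MetricSpace X] {φ : ℝ → X → X} {E B : Set X}
    {𝒞 : Set (Set X)}
    (hφ : ContinuousOn (fun q : ℝ × X => φ q.1 q.2) (Ici 0 ×ˢ E))
    (hE : ∀ t, 0 ≤ t → MapsTo (φ t) E E) (hzero : ∀ p ∈ E, φ 0 p = p)
    (hadd : ∀ p ∈ E, ∀ s t, 0 ≤ s → 0 ≤ t → φ (t + s) p = φ t (φ s p))
    (hBE : B ⊆ E) (hB : IsCompact B) (hB𝒞 : B ∈ 𝒞) (h𝒞E : ∀ C ∈ 𝒞, C ⊆ E)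
    (habs : ∀ C ∈ 𝒞, ∃ T, 0 ≤ T ∧ ∀ t, T ≤ t → MapsTo (φ t) C B) :
    ∃ A ⊆ E, IsCompact A ∧ (∀ t, 0 ≤ t → φ t '' A = A) ∧
      ∀ C ∈ 𝒞, ∀ e > 0, ∀ᶠ t in atTop, ∀ p ∈ C, ∃ a ∈ A, edist (φ t p) a ≤ ENNReal.ofReal e := by
  obtain ⟨T, hT, hTB⟩ := habs B hB𝒞
  have hcont : ∀ t, 0 ≤ t → ContinuousOn (φ t) E := fun t ht =>
    hφ.comp (f := fun p => (t, p)) (by fun_prop) fun p hp => ⟨ht, hp⟩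
  -- `B` need not be forward invariant. Its orbit over `[0, T]` is, because `B` returns to itself
  -- after time `T`; hence the images of `D` decrease.
  set D : Set X := (fun q : ℝ × X => φ q.1 q.2) '' (Icc 0 T ×ˢ B)
  have hD : IsCompact D := (isCompact_Icc.prod hB).image_of_continuousOn
    (hφ.mono (prod_mono Icc_subset_Ici_self hBE))
  have hDE : D ⊆ E := by
    rintro _ ⟨⟨t, p⟩, ⟨ht, hp⟩, rfl⟩
    exact hE t ht.1 (hBE hp)
  have hBD : B ⊆ D := fun p hp => ⟨(0, p), ⟨⟨le_rfl, hT⟩, hp⟩, hzero p (hBE hp)⟩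
  have hDD : ∀ t, 0 ≤ t → MapsTo (φ t) D D := by
    rintro t ht _ ⟨⟨s, p⟩, ⟨hs, hp⟩, rfl⟩
    simp only at hp ⊢
    rw [← hadd p (hBE hp) s t hs.1 ht]
    rcases le_total (t + s) T with h | h
    · exact ⟨(t + s, p), ⟨⟨add_nonneg ht hs.1, h⟩, hp⟩, rfl⟩
    · exact hBD (hTB _ h hp)
  set V : ℕ → Set X := fun k => φ k '' D
  have hVc : ∀ k, IsCompact (V k) := fun k =>
    hD.image_of_continuousOn ((hcont k k.cast_nonneg).mono hDE)
  have hanti : ∀ s t : ℝ, 0 ≤ s → s ≤ t → φ t '' D ⊆ φ s '' D := by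
    rintro s t hs hst _ ⟨p, hp, rfl⟩
    refine ⟨φ (t - s) p, hDD _ (by linarith) hp, ?_⟩
    rw [← hadd p (hDE hp) _ _ (by linarith) hs, add_sub_cancel]
  have hVanti : Antitone V := fun i j hij => hanti _ _ i.cast_nonneg (Nat.cast_le.2 hij)
  have hVdir : Directed (· ⊇ ·) V := directed_of_isDirected_le fun i j hij => hVanti hij
  have hAD : ⋂ k, V k ⊆ D := (iInter_subset V 0).trans (by
    rintro _ ⟨p, hp, rfl⟩
    exact hDD _ (by simp) hp)
  refine ⟨⋂ k, V k, hAD.trans hDE, (hVc 0).of_isClosed_subset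
    (isClosed_iInter fun k => (hVc k).isClosed) (iInter_subset _ _), fun t ht => ?_, fun C hC e he => ?_⟩
  · refine Subset.antisymm ?_ ?_
    · rintro _ ⟨p, hp, rfl⟩
      refine mem_iInter.2 fun k => ?_
      obtain ⟨q, hq, rfl⟩ := mem_iInter.1 hp k
      refine ⟨φ t q, hDD t ht hq, ?_⟩
      rw [← hadd q (hDE hq) _ _ ht k.cast_nonneg, ← hadd q (hDE hq) _ _ k.cast_nonneg ht, add_comm]
    · intro p hp
      -- A preimage of `p` in the intersection comes from nested nonempty compact sets: `p` lies in
      -- `φ (t + k) '' D`, so it has a preimage in each `V k`.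
      have hW : ∀ k, IsCompact (V k ∩ (φ t ⁻¹' {p})) ∧ (V k ∩ (φ t ⁻¹' {p})).Nonempty := by
        intro k
        have hVE : V k ⊆ E := by
          rintro _ ⟨q, hq, rfl⟩
          exact hE _ k.cast_nonneg (hDE hq)
        constructor
        · exact (hVc k).of_isClosed_subset (((hcont t ht).mono hVE).preimage_isClosed_of_isClosed
            (hVc k).isClosed isClosed_singleton) inter_subset_left
        · obtain ⟨j, hj⟩ := exists_nat_ge (t + k)
          have h1 := hanti (t + k) j (by positivity) hj (mem_iInter.1 hp j)
          obtain ⟨q, hq, rfl⟩ := h1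
          exact ⟨φ k q, ⟨q, hq, rfl⟩, (hadd q (hDE hq) _ _ k.cast_nonneg ht).symm⟩
      obtain ⟨q, hq⟩ := IsCompact.nonempty_iInter_of_directed_nonempty_isCompact_isClosed
        (fun k => V k ∩ (φ t ⁻¹' {p}))
        (directed_of_isDirected_le fun i j hij => inter_subset_inter_left _ (hVanti hij))
        (fun k => (hW k).2) (fun k => (hW k).1) (fun k => (hW k).1.isClosed)
      rw [mem_iInter] at hq
      exact ⟨q, mem_iInter.2 fun k => (hq k).1, (hq 0).2⟩
  · obtain ⟨k, hk⟩ := exists_subset_nhds_of_isCompact hVdir hVc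
      (U := Metric.thickening e (⋂ k, V k))
      fun p hp => Metric.isOpen_thickening.mem_nhds (Metric.self_subset_thickening he _ hp)
    obtain ⟨T', hT', hC'⟩ := habs C hC
    filter_upwards [eventually_ge_atTop (k + T')] with t ht p hp
    have h1 : φ t p ∈ V k := by
      refine ⟨φ (t - k) p, hBD (hC' _ (by linarith) hp), ?_⟩
      rw [← hadd p (h𝒞E C hC hp) _ _ (by linarith) k.cast_nonneg, add_sub_cancel]
    obtain ⟨a, ha, hd⟩ := Metric.mem_thickening_iff.1 (hk h1)
    exact ⟨a, ha, by rw [edist_dist]; exact ENNReal.ofReal_le_ofReal hd.le⟩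

/-! ### The global attractor and its inflated fibers -/

section Attractor

variable {g : FastField n m} [MetricSpace (Hull g)] {K₀ : Set (Vec n)}

/-- A point reachable after arbitrarily long times from a bounded set lies in the attractor. -/
theorem IsGlobalAttractor.mem_of_forall_mem_image {A : Set (Hull g × Vec n × Vec m)}
    (hA : IsGlobalAttractor g K₀ A) {D : Set (Vec m)} (hD : Bornology.IsBounded D)
    {p : Hull g × Vec n × Vec m}
    (hp : ∀ k : ℕ, p ∈ layeredSemiflow (k : ℝ) '' (omegaSet g ×ˢ K₀ ×ˢ D)) : p ∈ A := by
  rw [← hA.isCompact.isClosed.closure_eq, Metric.mem_closure_iff_infEDist_zero]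
  refine le_antisymm (ge_of_tendsto ((hA.attracts D hD).comp tendsto_natCast_atTop_atTop) ?_)
    zero_le
  exact Eventually.of_forall fun k =>
    le_iSup₂ (f := fun a (_ : a ∈ layeredSemiflow (k : ℝ) '' (omegaSet g ×ˢ K₀ ×ˢ D)) =>
      Metric.infEDist a A) p (hp k)

/-- By invariance each point of `A'` is reached after every time `k` from `A'`, whose fast
components form a bounded set; so `A` attracts it. -/
theorem IsGlobalAttractor.subset_of_isGlobalAttractor {A A' : Set (Hull g × Vec n × Vec m)}
    (hA : IsGlobalAttractor g K₀ A) (hA' : IsGlobalAttractor g K₀ A') : A' ⊆ A := by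
  intro p hp
  have hD : IsCompact ((fun p : Hull g × Vec n × Vec m => p.2.2) '' A') :=
    hA'.isCompact.image (by fun_prop)
  refine hA.mem_of_forall_mem_image hD.isBounded fun k => ?_
  rw [← hA'.invariant k k.cast_nonneg] at hp
  refine image_mono (fun q hq => ?_) hp
  exact ⟨(hA'.subset hq).1, (hA'.subset hq).2.1, mem_image_of_mem _ hq⟩

theorem exists_isGlobalAttractor [CompactSpace (Hull g)] (hd : IsHullMetric g)
    (hg : LipschitzInFast g) (hlayer : LayerAssumptions g) (hK₀ : IsCompact K₀) :
    ∃ A : Set (Hull g × Vec n × Vec m), IsGlobalAttractor g K₀ A := by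
  obtain ⟨c, hc, habs⟩ := exists_absorbing_bound hd hg hlayer hK₀
  have hsub : omegaSet g ⊆ forwardHull g := subset_union_right
  have hzero : ∀ p ∈ omegaSet g ×ˢ K₀ ×ˢ (univ : Set (Vec m)), layeredSemiflow 0 p = p := by
    rintro ⟨h, x, y₀⟩ hp
    simp [layeredSemiflow, (hlayer.isLayerSolution (hsub hp.1) x y₀).1]
  have hadd : ∀ p ∈ omegaSet g ×ˢ K₀ ×ˢ (univ : Set (Vec m)), ∀ s t : ℝ, 0 ≤ s → 0 ≤ t →
      layeredSemiflow (t + s) p = layeredSemiflow t (layeredSemiflow s p) := by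
    rintro ⟨h, x, y₀⟩ hp s t hs ht
    simp [layeredSemiflow, layerSol_add hd hg hlayer (hsub hp.1) x y₀ hs ht, Hull.flow_flow]
  have habs' : ∀ C ∈ {C | ∃ D : Set (Vec m), Bornology.IsBounded D ∧ C = omegaSet g ×ˢ K₀ ×ˢ D},
      ∃ T, 0 ≤ T ∧ ∀ t, T ≤ t →
        MapsTo (layeredSemiflow t) C (omegaSet g ×ˢ K₀ ×ˢ Metric.closedBall (0 : Vec m) c) := by
    rintro _ ⟨D, hD, rfl⟩
    obtain ⟨ρ, hρ⟩ := hD.subset_closedBall 0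
    obtain ⟨T, hT, H⟩ := habs ρ
    refine ⟨T, hT, fun t ht p hp => ⟨flow_mem_omegaSet hd hp.1 t, hp.2.1, ?_⟩⟩
    simpa [layeredSemiflow] using H p.1 (hsub hp.1) p.2.1 hp.2.1 t ht p.2.2 (by simpa using hρ hp.2.2)
  obtain ⟨A, hAE, hAc, hinv, hattr⟩ := exists_attractor (E := omegaSet g ×ˢ K₀ ×ˢ univ)
    (𝒞 := {C | ∃ D : Set (Vec m), Bornology.IsBounded D ∧ C = omegaSet g ×ˢ K₀ ×ˢ D})
    ((continuousOn_layeredSemiflow hd hg hlayer).mono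
      (prod_mono Subset.rfl (prod_mono hsub (subset_univ _))))
    (fun t _ p hp => ⟨flow_mem_omegaSet hd hp.1 t, hp.2.1, trivial⟩) hzero hadd
    (prod_mono Subset.rfl (prod_mono Subset.rfl (subset_univ _)))
    (isClosed_omegaSet.isCompact.prod (hK₀.prod (isCompact_closedBall _ _)))
    ⟨_, Metric.isBounded_closedBall, rfl⟩
    (by
      rintro _ ⟨D, -, rfl⟩
      exact prod_mono Subset.rfl (prod_mono Subset.rfl (subset_univ _))) habs'
  refine ⟨A, hAE, hAc, hinv, fun D hD => ENNReal.tendsto_nhds_zero.2 fun e he => ?_⟩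
  obtain ⟨e', he', hlt⟩ := ENNReal.lt_iff_exists_nnreal_btwn.1 he
  filter_upwards [hattr _ ⟨D, hD, rfl⟩ e' (by exact_mod_cast he')] with t ht
  refine iSup₂_le ?_
  rintro _ ⟨p, hp, rfl⟩
  obtain ⟨a, ha, hpa⟩ := ht p hp
  exact (Metric.infEDist_le_edist_of_mem ha).trans (hpa.trans (by simpa using hlt.le))

theorem existsUnique_isGlobalAttractor [CompactSpace (Hull g)] (hd : IsHullMetric g)
    (hg : LipschitzInFast g) (hlayer : LayerAssumptions g) (hK₀ : IsCompact K₀) :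
    ∃! A : Set (Hull g × Vec n × Vec m), IsGlobalAttractor g K₀ A := by
  obtain ⟨A, hA⟩ := exists_isGlobalAttractor hd hg hlayer hK₀
  exact ⟨A, hA, fun A' hA' => (hA.subset_of_isGlobalAttractor hA').antisymm
    (hA'.subset_of_isGlobalAttractor hA)⟩

theorem IsGlobalAttractor.inflatedFiber_eq_image {A : Set (Hull g × Vec n × Vec m)}
    (hA : IsGlobalAttractor g K₀ A) (h : Hull g) (x : Vec n) (δ : ℝ) :
    inflatedFiber K₀ A h x δ = (fun p : Hull g × Vec n × Vec m => p.2.2) ''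
      (A ∩ {p | dist p.1 h ≤ δ ∧ ‖p.2.1 - x‖ ≤ δ}) := by
  ext y
  simp only [inflatedFiber, fiber, mem_iUnion, mem_ofPred_eq, mem_image, mem_inter_iff, Prod.exists]
  constructor
  · rintro ⟨h', x', ⟨_, _, h1, h2⟩, h3⟩
    exact ⟨h', x', y, ⟨h3, h1, h2⟩, rfl⟩
  · rintro ⟨h', x', y', ⟨h3, h1, h2⟩, rfl⟩
    exact ⟨h', x', ⟨(hA.subset h3).1, (hA.subset h3).2.1, h1, h2⟩, h3⟩

/-- A radius is admissible if it bounds the distances to a point of the attractor. -/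
theorem IsGlobalAttractor.mem_radiusSet {A : Set (Hull g × Vec n × Vec m)}
    (hA : IsGlobalAttractor g K₀ A) {p : Hull g × Vec n × Vec m} (hp : p ∈ A) {h : Hull g}
    {x : Vec n} {y : Vec m} {δ : ℝ} (hδ : 0 < δ) (h1 : dist p.1 h ≤ δ) (h2 : ‖p.2.1 - x‖ ≤ δ)
    (h3 : dist p.2.2 y ≤ δ) : δ ∈ radiusSet K₀ A h x y := by
  refine ⟨hδ, ?_, ?_⟩
  · refine (Metric.infEDist_le_edist_of_mem (hA.subset hp).1).trans ?_
    rw [edist_comm, edist_dist]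
    exact ENNReal.ofReal_le_ofReal h1
  · have hmem : p.2.2 ∈ inflatedFiber K₀ A h x δ := by
      rw [hA.inflatedFiber_eq_image]
      exact ⟨p, ⟨hp, h1, h2⟩, rfl⟩
    refine (Metric.infEDist_le_edist_of_mem hmem).trans ?_
    rw [edist_comm, edist_dist]
    exact ENNReal.ofReal_le_ofReal h3

/-- The inflated fiber is a projected closed slice of the compact set `A`, and is nonempty because
the distance to it is finite; so the distance is attained. -/
theorem IsGlobalAttractor.exists_of_mem_radiusSet {A : Set (Hull g × Vec n × Vec m)}
    (hA : IsGlobalAttractor g K₀ A) {h : Hull g} {x : Vec n} {y : Vec m} {δ : ℝ}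
    (hδ : δ ∈ radiusSet K₀ A h x y) :
    ∃ p ∈ A, dist p.1 h ≤ δ ∧ ‖p.2.1 - x‖ ≤ δ ∧ dist y p.2.2 ≤ δ := by
  obtain ⟨hpos, -, hle⟩ := hδ
  have hcl : IsClosed {p : Hull g × Vec n × Vec m | dist p.1 h ≤ δ ∧ ‖p.2.1 - x‖ ≤ δ} :=
    (isClosed_le (f := fun p : Hull g × Vec n × Vec m => dist p.1 h) (by fun_prop)
      continuous_const).inter
    (isClosed_le (f := fun p : Hull g × Vec n × Vec m => ‖p.2.1 - x‖) (by fun_prop)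
      continuous_const)
  have hcomp : IsCompact (inflatedFiber K₀ A h x δ) := by
    rw [hA.inflatedFiber_eq_image]
    exact (hA.isCompact.inter_right hcl).image (by fun_prop)
  have hne : (inflatedFiber K₀ A h x δ).Nonempty := by
    by_contra hempty
    rw [not_nonempty_iff_eq_empty] at hempty
    rw [hempty, Metric.infEDist_empty] at hle
    simp at hle
  obtain ⟨w, hw, heq⟩ := hcomp.exists_infEDist_eq_edist hne y
  rw [heq, edist_dist, ENNReal.ofReal_le_ofReal_iff hpos.le] at hle
  rw [hA.inflatedFiber_eq_image] at hw
  obtain ⟨p, ⟨hp, h1, h2⟩, rfl⟩ := hw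
  exact ⟨p, hp, h1, h2, hle⟩

/-- The infimum of the admissible radii satisfies the distance estimate. -/
theorem IsGlobalAttractor.infEDist_inflatedFiber_sInf_le {A : Set (Hull g × Vec n × Vec m)}
    (hA : IsGlobalAttractor g K₀ A) {h : Hull g} {x : Vec n} {y : Vec m}
    (hne : (radiusSet K₀ A h x y).Nonempty) :
    Metric.infEDist y (inflatedFiber K₀ A h x (sInf (radiusSet K₀ A h x y))) ≤
      ENNReal.ofReal (sInf (radiusSet K₀ A h x y)) := by
  -- The infimum may be `0`, which is not an admissible radius, so nearest attractor points for
  -- radii tending to it are passed to the limit by compactness.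
  obtain ⟨d, -, hlim, hd⟩ := exists_seq_tendsto_sInf hne ⟨0, fun _ hδ => hδ.1.le⟩
  choose p hpA h1 h2 h3 using fun k => hA.exists_of_mem_radiusSet (hd k)
  obtain ⟨q, hq, φ, hφ, hlimq⟩ := hA.isCompact.tendsto_subseq hpA
  have hlim' := hlim.comp hφ.tendsto_atTop
  have hmem : q.2.2 ∈ inflatedFiber K₀ A h x (sInf (radiusSet K₀ A h x y)) := by
    rw [hA.inflatedFiber_eq_image]
    refine ⟨q, ⟨hq, ?_, ?_⟩, rfl⟩
    · exact le_of_tendsto_of_tendsto'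
        (((by fun_prop : Continuous fun p : Hull g × Vec n × Vec m => dist p.1 h).tendsto q).comp
          hlimq) hlim' fun k => h1 (φ k)
    · exact le_of_tendsto_of_tendsto'
        (((by fun_prop : Continuous fun p : Hull g × Vec n × Vec m => ‖p.2.1 - x‖).tendsto q).comp
          hlimq) hlim' fun k => h2 (φ k)
  refine (Metric.infEDist_le_edist_of_mem hmem).trans ?_
  rw [edist_dist]
  refine ENNReal.ofReal_le_ofReal (le_of_tendsto_of_tendsto'
    (((by fun_prop : Continuous fun p : Hull g × Vec n × Vec m => dist y p.2.2).tendsto q).comp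
      hlimq) hlim' fun k => h3 (φ k))

end Attractor

/-! ### Slow-fast solutions in the fast time -/

theorem isCompact_tube {x₀ : ℝ → Vec n} {t₀ : ℝ} (hx₀ : ContinuousOn x₀ (Icc 0 t₀)) (r : ℝ) :
    IsCompact (tube x₀ t₀ r) := by
  convert (isCompact_Icc.image_of_continuousOn hx₀).add (isCompact_closedBall (0 : Vec n) r)
  ext z
  simp only [tube, mem_ofPred_eq, Set.mem_add, mem_image, Metric.mem_closedBall, dist_zero_right]
  constructor
  · rintro ⟨t, ht, v, hv, rfl⟩
    exact ⟨_, ⟨t, ht, rfl⟩, v, hv, rfl⟩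
  · rintro ⟨_, ⟨t, ht, rfl⟩, v, hv, rfl⟩
    exact ⟨t, ht, v, hv, rfl⟩

theorem mem_tube_of_dist_le {x₀ : ℝ → Vec n} {t₀ r t : ℝ} (ht : t ∈ Icc 0 t₀) {z : Vec n}
    (hz : dist z (x₀ t) ≤ r) : z ∈ tube x₀ t₀ r :=
  ⟨t, ht, z - x₀ t, by rwa [← dist_eq_norm], by simp⟩

theorem SolvesOn.mono {h : FastField n m} {ξ : ℝ → Vec n} {a b a' b' : ℝ} {Z : ℝ → Vec m}
    (hZ : SolvesOn h ξ a b Z) (ha : a ≤ a') (hb : b' ≤ b) : SolvesOn h ξ a' b' Z where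
  continuousOn := hZ.continuousOn.mono (Icc_subset_Icc ha hb)
  deriv s hs := hZ.deriv s ⟨ha.trans hs.1, hs.2.trans_le hb⟩

theorem IsSlowFastSolution.solvesOn {f : Vec n → Vec m → Vec n} {g : FastField n m} {ε t₀ : ℝ}
    {ξ : Vec n} {η : Vec m} {x : ℝ → Vec n} {y : ℝ → Vec m} (hε : 0 < ε)
    (h : IsSlowFastSolution f g ε t₀ ξ η x y) :
    SolvesOn g (fun τ => x (ε * τ)) 0 (t₀ / ε) (inFastTime ε y) := by
  have hmaps : MapsTo (fun τ : ℝ => ε * τ) (Icc 0 (t₀ / ε)) (Icc 0 t₀) := by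
    intro τ hτ
    refine ⟨mul_nonneg hε.le hτ.1, ?_⟩
    have := (le_div_iff₀ hε).1 hτ.2
    linarith
  have hderiv : ∀ τ ∈ Icc 0 (t₀ / ε), HasDerivWithinAt (inFastTime ε y)
      (g (x (ε * τ), inFastTime ε y τ, τ)) (Icc 0 (t₀ / ε)) τ := by
    intro τ hτ
    have h1 : HasDerivWithinAt (fun τ : ℝ => ε * τ) ε (Icc 0 (t₀ / ε)) τ := by
      simpa using (hasDerivWithinAt_id τ _).const_mul ε
    have h2 := (h.y_deriv _ (hmaps hτ)).scomp τ h1 hmaps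
    rwa [smul_smul, mul_inv_cancel₀ hε.ne', one_smul, mul_div_cancel_left₀ _ hε.ne'] at h2
  refine ⟨fun τ hτ => (hderiv τ hτ).continuousWithinAt, fun τ hτ => ?_⟩
  refine (hderiv τ (Ico_subset_Icc_self hτ)).mono_of_mem_nhdsWithin ?_
  filter_upwards [self_mem_nhdsWithin, nhdsWithin_le_nhds (Iio_mem_nhds hτ.2)] with s h1 h2
  exact ⟨hτ.1.trans h1, le_of_lt h2⟩

/-- Over slow times of length `ε k * S` the slow component barely moves. -/
theorem eventually_dist_lt {x : ℕ → ℝ → Vec n} {x₀ : ℝ → Vec n} {t₀ : ℝ}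
    (hx₀c : ContinuousOn x₀ (Icc 0 t₀)) (hx₀ : TendstoUniformlyOn x x₀ atTop (Icc 0 t₀))
    {ε : ℕ → ℝ} (hε_lim : Tendsto ε atTop (𝓝 0)) (S : ℝ) {e : ℝ} (he : 0 < e) :
    ∀ᶠ k in atTop, ∀ t ∈ Icc 0 t₀, ∀ t' ∈ Icc 0 t₀, |t - t'| ≤ ε k * S →
      dist (x k t) (x₀ t') < e := by
  obtain ⟨δ, hδ, hunif⟩ := Metric.uniformContinuousOn_iff.1
    (isCompact_Icc.uniformContinuousOn_of_continuous hx₀c) (e / 2) (by positivity)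
  have hlim : Tendsto (fun k => ε k * S) atTop (𝓝 0) := by simpa using hε_lim.mul_const S
  filter_upwards [Metric.tendstoUniformlyOn_iff.1 hx₀ (e / 2) (by positivity),
    hlim.eventually_lt_const hδ] with k h1 h2 t ht t' ht' htt
  have h3 := h1 t ht
  rw [dist_comm] at h3
  calc _ ≤ _ := dist_triangle _ _ _
    _ < e / 2 + e / 2 := add_lt_add h3 (hunif t ht t' ht' (htt.trans_lt h2))
    _ = e := add_halves e

section SlowFastSystem

variable {f : Vec n → Vec m → Vec n} {g : FastField n m} [MetricSpace (Hull g)]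
  {ξ : Vec n} {η : Vec m} {t₀ : ℝ} {ε : ℕ → ℝ} {x : ℕ → ℝ → Vec n} {y : ℕ → ℝ → Vec m}
  {x₀ : ℝ → Vec n}

/-- The fast components are bounded uniformly along the sequence. -/
theorem exists_eventually_norm_le [CompactSpace (Hull g)] (hd : IsHullMetric g)
    (hfg : BasicAssumptions f g) (hlayer : LayerAssumptions g)
    (hε_pos : ∀ k, 0 < ε k) (hε_lim : Tendsto ε atTop (𝓝 0))
    (hsol : ∀ k, IsSlowFastSolution f g (ε k) t₀ ξ η (x k) (y k))
    (hx₀c : ContinuousOn x₀ (Icc 0 t₀)) (hx₀ : TendstoUniformlyOn x x₀ atTop (Icc 0 t₀)) :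
    ∃ R : ℝ, ∀ᶠ k in atTop, ∀ τ ∈ Icc 0 (t₀ / ε k), ‖inFastTime (ε k) (y k) τ‖ ≤ R := by
  have hg := hfg.lipschitzInFast
  have hK₀ : IsCompact (tube x₀ t₀ 1) := isCompact_tube hx₀c 1
  obtain ⟨c, hc, habs⟩ := exists_absorbing_bound hd hg hlayer hK₀
  -- `‖η‖` starts the induction over windows; `c + 1` closes it, as after time `T` the frozen
  -- solution is below `c` and the error is at most `1`.
  set ρ := max ‖η‖ (c + 1)
  obtain ⟨T₁, hT₁, HT₁⟩ := habs ρ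
  set T := max T₁ 1
  have hT : 0 < T := by positivity
  obtain ⟨R, hR⟩ := exists_bound_layerSol hd hg hlayer hK₀ ρ T
  have hball : IsCompact (Metric.closedBall (0 : Vec m) (R + 1)) := isCompact_closedBall _ _
  obtain ⟨L, hL⟩ := hg _ _ hK₀ hball
  -- Keeps the barrier at most `1` over a window of length `T`. The resulting `δ` is independent of
  -- the window's position, since the uniform continuity holds for all times.
  set α := Real.exp (-((max L 0 + 1) * T))
  have hα : 0 < α := by positivity
  obtain ⟨δ, hδ, hunif⟩ := Metric.uniformContinuousOn_iff.1
    (hfg.g_uniformContinuous _ (hK₀.prod hball)) α hα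
  refine ⟨R + 1, ?_⟩
  filter_upwards [eventually_dist_lt hx₀c hx₀ hε_lim T (e := min (δ / 2) 1) (by positivity)]
    with k hk
  have hε := hε_pos k
  set N := t₀ / ε k
  set Y := inFastTime (ε k) (y k)
  have hY := (hsol k).solvesOn hε
  have hmaps : ∀ τ ∈ Icc 0 N, ε k * τ ∈ Icc 0 t₀ := by
    intro τ hτ
    refine ⟨mul_nonneg hε.le hτ.1, ?_⟩
    have := (le_div_iff₀ hε).1 hτ.2
    linarith
  have hxT : ∀ τ ∈ Icc 0 N, x k (ε k * τ) ∈ tube x₀ t₀ 1 := fun τ hτ =>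
    mem_tube_of_dist_le (hmaps τ hτ) ((hk _ (hmaps τ hτ) _ (hmaps τ hτ)
      (by simp; positivity)).le.trans (min_le_right _ _))
  have hxclose : ∀ τ ∈ Icc 0 N, ∀ τ' ∈ Icc 0 N, |τ - τ'| ≤ T →
      dist (x k (ε k * τ)) (x k (ε k * τ')) < δ := by
    intro τ hτ τ' hτ' hττ
    have h1 := hk _ (hmaps τ hτ) _ (hmaps τ' hτ') (by
      rw [← mul_sub, abs_mul, abs_of_pos hε]; gcongr)
    have h2 := hk _ (hmaps τ' hτ') _ (hmaps τ' hτ') (by simp; positivity)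
    rw [dist_comm] at h2
    have h3 := min_le_left (δ / 2) 1
    linarith [dist_triangle (x k (ε k * τ)) (x₀ (ε k * τ')) (x k (ε k * τ'))]
  -- One window: `Y` is compared with the layer solution whose parameter is frozen at its value at
  -- `a`.
  have hstep : ∀ a ∈ Icc 0 N, ‖Y a‖ ≤ ρ → ∀ s ∈ Icc a N, s ≤ a + T →
      ‖Y s‖ ≤ R + 1 ∧ (a + T ≤ s → ‖Y s‖ ≤ ρ) := by
    intro a ha hYa s hs hsT
    set u := layerSol g (x k (ε k * a)) a (Y a)
    have hu := hlayer.isLayerSolution_base (x k (ε k * a)) ha.1 (Y a)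
    have huflow : ∀ t, a ≤ t → u t =
        layerSol ((Hull.base g).flow a).field (x k (ε k * a)) 0 (Y a) (t - a) := by
      intro t ht
      rw [← layerSol_base_add hg hlayer _ ha.1 _ (by linarith), sub_add_cancel]
    have hmemf : (Hull.base g).flow a ∈ forwardHull g := Or.inl ⟨a, ha.1, rfl⟩
    have huR : ∀ t ∈ Icc a s, ‖u t‖ ≤ R := by
      intro t ht
      rw [huflow t ht.1]
      exact hR _ hmemf _ (hxT a ha) _ hYa _ ⟨by linarith [ht.1], by linarith [ht.2]⟩
    have hmemball : ∀ t ∈ Icc a s, ∀ w, ‖w - u t‖ ≤ 1 →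
        w ∈ Metric.closedBall (0 : Vec m) (R + 1) := by
      intro t ht w hw
      simp only [Metric.mem_closedBall, dist_zero_right]
      linarith [norm_sub_norm_le w (u t), huR t ht]
    have hYs := hY.mono ha.1 hs.2
    have hus := hu.solvesOn le_rfl s
    have hexp : α * Real.exp ((max L 0 + 1) * (s - a)) ≤ 1 := by
      simp only [α]
      rw [← Real.exp_add, Real.exp_le_one_iff]
      have : (max L 0 + 1) * (s - a) ≤ (max L 0 + 1) * T := by gcongr; linarith
      linarith
    have hb := norm_sub_le_of_approx_solution
      (v := fun t w => g (x k (ε k * a), w, t)) (u := u) (Z := Y) (β := 1) hα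
      hus.continuousOn hus.deriv hYs.continuousOn hYs.deriv (le_max_right L 0)
      (fun t ht w hw => ?_) (fun t ht hw => ?_) hexp (by simpa [u, hu.1] using hα.le) s
      ⟨hs.1, le_rfl⟩
    · have hle := hb.trans hexp
      have h1 := norm_sub_norm_le (Y s) (u s)
      refine ⟨by linarith [huR s ⟨hs.1, le_rfl⟩], fun hTs => ?_⟩
      have h2 : ‖u s‖ ≤ c := by
        rw [huflow s hs.1]
        exact HT₁ _ hmemf _ (hxT a ha) _ (by linarith [le_max_left T₁ 1]) _ hYa
      exact le_trans (by linarith) (le_max_right _ _)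
    · have ht' := Ico_subset_Icc_self ht
      refine (hL _ (hxT a ha) w (hmemball t ht' w hw) _ (hmemball t ht' _ (by simp)) t).trans ?_
      gcongr
      exact le_max_left _ _
    · have ht' := Ico_subset_Icc_self ht
      have htN : t ∈ Icc 0 N := ⟨ha.1.trans ht'.1, ht'.2.trans hs.2⟩
      have hwm := hmemball t ht' _ hw
      have hx := hxclose t htN a ha (by
        rw [abs_of_nonneg (by linarith [ht'.1])]; linarith [ht'.2])
      rw [← dist_eq_norm]
      exact hunif ((x k (ε k * t), Y t), t) ⟨⟨hxT t htN, hwm⟩, trivial⟩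
        ((x k (ε k * a), Y t), t) ⟨⟨hxT a ha, hwm⟩, trivial⟩ (by
          simpa [Prod.dist_eq, hδ] using hx)
  have hgrid : ∀ j : ℕ, j * T ≤ N → ‖Y (j * T)‖ ≤ ρ := by
    intro j
    induction j with
    | zero =>
      intro _
      simp only [Nat.cast_zero, zero_mul, Y, inFastTime, mul_zero, (hsol k).y_init]
      exact le_max_left _ _
    | succ j ih =>
      intro hj
      push_cast at hj ⊢
      have hjN : j * T ≤ N := by linarith
      exact (hstep (j * T) ⟨by positivity, hjN⟩ (ih hjN) ((j + 1) * T) ⟨by linarith, hj⟩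
        (by linarith)).2 (by linarith)
  intro τ hτ
  have h1 : ⌊τ / T⌋₊ * T ≤ τ := by
    rw [← le_div_iff₀ hT]
    exact Nat.floor_le (div_nonneg hτ.1 hT.le)
  have h2 : τ ≤ ⌊τ / T⌋₊ * T + T := by
    have := (div_lt_iff₀ hT).1 (Nat.lt_floor_add_one (τ / T))
    linarith
  exact (hstep (⌊τ / T⌋₊ * T) ⟨by positivity, h1.trans hτ.2⟩ (hgrid _ (h1.trans hτ.2)) τ
    ⟨h1, hτ.2⟩ h2).1

/-- Limit points of the final fast states lie in the attractor. -/
theorem exists_tendsto_mem_attractor [CompactSpace (Hull g)] (hd : IsHullMetric g)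
    (hfg : BasicAssumptions f g) (hlayer : LayerAssumptions g) (ht₀ : 0 < t₀)
    (hε_pos : ∀ k, 0 < ε k) (hε_lim : Tendsto ε atTop (𝓝 0))
    (hsol : ∀ k, IsSlowFastSolution f g (ε k) t₀ ξ η (x k) (y k))
    (hx₀c : ContinuousOn x₀ (Icc 0 t₀)) (hx₀ : TendstoUniformlyOn x x₀ atTop (Icc 0 t₀))
    {r : ℝ} (hr : 0 ≤ r) {A : Set (Hull g × Vec n × Vec m)}
    (hA : IsGlobalAttractor g (tube x₀ t₀ r) A) (U : Ultrafilter ℕ) (hU : (U : Filter ℕ) ≤ atTop) :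
    ∃ (h₀ : Hull g) (y₁ : Vec m),
      Tendsto (fun k => (Hull.base g).flow (t₀ / ε k)) U (𝓝 h₀) ∧
      Tendsto (fun k => inFastTime (ε k) (y k) (t₀ / ε k)) U (𝓝 y₁) ∧ (h₀, x₀ t₀, y₁) ∈ A := by
  have hg := hfg.lipschitzInFast
  obtain ⟨R, hR⟩ := exists_eventually_norm_le hd hfg hlayer hε_pos hε_lim hsol hx₀c hx₀
  have hN : Tendsto (fun k => t₀ / ε k) U atTop := by
    have : Tendsto ε atTop (𝓝[>] 0) :=
      tendsto_nhdsWithin_iff.2 ⟨hε_lim, Eventually.of_forall hε_pos⟩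
    exact ((this.inv_tendsto_nhdsGT_zero).const_mul_atTop ht₀).mono_left hU
  have hlimit : ∀ τ : ℕ → ℝ, (∀ᶠ k in (U : Filter ℕ), τ k ∈ Icc 0 (t₀ / ε k)) →
      ∃ z ∈ Metric.closedBall (0 : Vec m) R,
        Tendsto (fun k => inFastTime (ε k) (y k) (τ k)) U (𝓝 z) := by
    intro τ hτ
    have hmem : ∀ᶠ k in (U : Filter ℕ),
        inFastTime (ε k) (y k) (τ k) ∈ Metric.closedBall (0 : Vec m) R := by
      filter_upwards [hU hR, hτ] with k h1 h2
      simpa using h1 _ h2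
    exact (isCompact_closedBall (0 : Vec m) R).ultrafilter_le_nhds
      (U.map fun k => inFastTime (ε k) (y k) (τ k)) (le_principal_iff.2 hmem)
  obtain ⟨h₀, -, hh₀⟩ := isCompact_univ.ultrafilter_le_nhds
    (U.map fun k => (Hull.base g).flow (t₀ / ε k)) (by simp)
  have hh₀ : Tendsto (fun k => (Hull.base g).flow (t₀ / ε k)) U (𝓝 h₀) := hh₀
  obtain ⟨y₁, -, hy₁⟩ := hlimit (fun k => t₀ / ε k)
    (Eventually.of_forall fun k => ⟨div_nonneg ht₀.le (hε_pos k).le, le_rfl⟩)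
  refine ⟨h₀, y₁, hh₀, hy₁, ?_⟩
  -- The radius `R` does not depend on `S`, so one bounded set serves all backward times.
  refine hA.mem_of_forall_mem_image (Metric.isBounded_closedBall (x := (0 : Vec m)) (r := R))
    fun S => ?_
  have hS : (0 : ℝ) ≤ S := S.cast_nonneg
  have hSN : ∀ᶠ k in (U : Filter ℕ), (S : ℝ) ≤ t₀ / ε k := hN.eventually_ge_atTop _
  obtain ⟨z, hz, hzlim⟩ := hlimit (fun k => t₀ / ε k - S) (by
    filter_upwards [hSN] with k hk
    exact ⟨by linarith, by linarith⟩)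
  have hflow : Tendsto (fun k => (Hull.base g).flow (t₀ / ε k - S)) U (𝓝 (h₀.flow (-S))) := by
    have hc : Continuous (fun h : Hull g => h.flow (-S)) :=
      (Hull.continuous_flow hd).comp (continuous_const.prodMk continuous_id)
    have h1 := (hc.tendsto h₀).comp hh₀
    simpa [Function.comp_def, Hull.flow_flow, sub_eq_neg_add] using h1
  have hO : h₀.flow (-S) ∈ omegaSet g :=
    mem_omegaSet_of_tendsto (tendsto_atTop_add_const_right _ (-(S : ℝ)) hN)
      (by simpa [sub_eq_add_neg] using hflow)
  have ht₀m : t₀ ∈ Icc 0 t₀ := ⟨ht₀.le, le_rfl⟩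
  refine ⟨(h₀.flow (-S), x₀ t₀, z), ⟨hO, mem_tube_of_dist_le ht₀m (by simpa using hr), hz⟩, ?_⟩
  have hu := hlayer.isLayerSolution (Or.inr hO) (x₀ t₀) z
  -- Restarted `S` units before the end, the fields tend to `h₀.flow (-S)` and the drifting
  -- parameters to `x₀ t₀`.
  have hconv := tendstoUniformlyOn_solution (l := (U : Filter ℕ)) (S := S)
    (hk := fun k => shift (t₀ / ε k - S) g) (h := (h₀.flow (-S)).field)
    (ξ := fun k s => x k (ε k * (s + (t₀ / ε k - S)))) (x := x₀ t₀)
    (Z := fun k s => inFastTime (ε k) (y k) (s + (t₀ / ε k - S)))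
    ((hd.continuous.tendsto _).comp hflow) (Hull.lipschitzInFast hg _) ?_ ?_
    (hu.solvesOn le_rfl S) (by rw [hu.1]; simpa using hzlim)
  · have h1 := hconv.tendsto_at (⟨hS, le_rfl⟩ : (S : ℝ) ∈ Icc 0 (S : ℝ))
    simp only [add_sub_cancel] at h1
    simp [layeredSemiflow, Hull.flow_flow, tendsto_nhds_unique hy₁ h1]
  · rw [Metric.tendstoUniformlyOn_iff]
    intro e he
    filter_upwards [hU (eventually_dist_lt hx₀c hx₀ hε_lim S he), hSN] with k hk hSk s hs
    have hε := hε_pos k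
    have heq : ε k * (s + (t₀ / ε k - S)) = t₀ - ε k * (S - s) := by
      field_simp
      ring
    have h1 : ε k * (S - s) ≤ ε k * S := by gcongr; linarith [hs.1]
    have h2 : 0 ≤ ε k * (S - s) := mul_nonneg hε.le (by linarith [hs.2])
    have h3 : ε k * S ≤ t₀ := by
      have := (le_div_iff₀ hε).1 hSk
      linarith
    rw [dist_comm, heq]
    refine hk _ ⟨by linarith, by linarith⟩ _ ht₀m ?_
    rw [abs_le]
    constructor <;> linarith
  · filter_upwards [hSN] with k hk
    have h1 := ((hsol k).solvesOn (hε_pos k)).comp_add (t₀ / ε k - S)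
    exact h1.mono (by linarith) (by linarith)

end SlowFastSystem

end SlowFast

/-! ### The main theorem -/

open SlowFast
theorem theorem5p11 {n m : ℕ} (f : Vec n → Vec m → Vec n) (g : FastField n m)
    [MetricSpace (Hull g)] (hd : IsHullMetric g)
    (hfg : BasicAssumptions f g) (hlayer : LayerAssumptions g)
    (ξ : Vec n) (η : Vec m) (t₀ : ℝ) (ht₀ : 0 < t₀)
    (ε : ℕ → ℝ) (hε_pos : ∀ k, 0 < ε k) (hε_lim : Tendsto ε atTop (𝓝 0))
    (x : ℕ → ℝ → Vec n) (y : ℕ → ℝ → Vec m)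
    (hsol : ∀ k, IsSlowFastSolution f g (ε k) t₀ ξ η (x k) (y k))
    (x₀ : ℝ → Vec n) (hx₀ : TendstoUniformlyOn x x₀ atTop (Icc 0 t₀))
    (r : ℝ) (hr : 0 < r) :
    (∃! A : Set (Hull g × Vec n × Vec m), IsGlobalAttractor g (tube x₀ t₀ r) A) ∧
    ∀ A : Set (Hull g × Vec n × Vec m), IsGlobalAttractor g (tube x₀ t₀ r) A →
    ∀ (gEnd : ℕ → Hull g) (yEnd : ℕ → Vec m) (δ : ℕ → ℝ),
      (∀ k, gEnd k = (Hull.base g).flow (t₀ / ε k)) →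
      (∀ k, yEnd k = inFastTime (ε k) (y k) (t₀ / ε k)) →
      (∀ k, δ k = sInf (radiusSet (tube x₀ t₀ r) A (gEnd k) (x₀ t₀) (yEnd k))) →
      (∀ k, (radiusSet (tube x₀ t₀ r) A (gEnd k) (x₀ t₀) (yEnd k)).Nonempty) ∧
      Tendsto δ atTop (𝓝 0) ∧
      Tendsto (fun k => Metric.infEDist (yEnd k)
        (inflatedFiber (tube x₀ t₀ r) A (gEnd k) (x₀ t₀) (δ k))) atTop (𝓝 0) ∧
      ∀ h₀ : Hull g, Tendsto gEnd atTop (𝓝 h₀) →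
        h₀ ∈ omegaSet g ∧
        Tendsto (fun k => Metric.infEDist (yEnd k) (fiber A h₀ (x₀ t₀))) atTop (𝓝 0) := by
  have hcs : CompactSpace (Hull g) := Hull.compactSpace hd hfg
  have hg := hfg.lipschitzInFast
  have hx₀c : ContinuousOn x₀ (Icc 0 t₀) := hx₀.continuousOn
    (Frequently.of_forall fun k t ht => ((hsol k).x_deriv t ht).continuousWithinAt)
  refine ⟨existsUnique_isGlobalAttractor hd hg hlayer (isCompact_tube hx₀c r), ?_⟩
  intro A hA gEnd yEnd δ hgEnd hyEnd hδ
  obtain rfl : gEnd = fun k => (Hull.base g).flow (t₀ / ε k) := funext hgEnd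
  obtain rfl : yEnd = fun k => inFastTime (ε k) (y k) (t₀ / ε k) := funext hyEnd
  have hlim := exists_tendsto_mem_attractor hd hfg hlayer ht₀ hε_pos hε_lim hsol hx₀c hx₀ hr.le hA
  have hne : ∀ k, (radiusSet (tube x₀ t₀ r) A ((Hull.base g).flow (t₀ / ε k)) (x₀ t₀)
      (inFastTime (ε k) (y k) (t₀ / ε k))).Nonempty := by
    intro k
    obtain ⟨h₀, y₁, -, -, hp⟩ := hlim (Ultrafilter.of atTop) (Ultrafilter.of_le _)
    set a := dist h₀ ((Hull.base g).flow (t₀ / ε k))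
    set b := dist y₁ (inFastTime (ε k) (y k) (t₀ / ε k))
    have ha : 0 ≤ a := dist_nonneg
    have hb : 0 ≤ b := dist_nonneg
    -- Any attractor point over `x₀ t₀` yields an admissible radius; the `1` makes it positive.
    exact ⟨a + b + 1, hA.mem_radiusSet hp (by positivity)
      (by change a ≤ _; linarith) (by simp; positivity) (by change b ≤ _; linarith)⟩
  have hδlim : Tendsto δ atTop (𝓝 0) := by
    rw [tendsto_iff_ultrafilter]
    intro U hU
    obtain ⟨h₀, y₁, h1, h2, hp⟩ := hlim U hU
    refine Metric.tendsto_nhds.2 fun e he => ?_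
    filter_upwards [Metric.tendsto_nhds.1 h1 (e / 2) (by positivity),
      Metric.tendsto_nhds.1 h2 (e / 2) (by positivity)] with k hk1 hk2
    rw [dist_comm] at hk1 hk2
    -- The limit point itself witnesses the radius `e / 2`, so `δ k ≤ e / 2`.
    have hmem := hA.mem_radiusSet hp (x := x₀ t₀) (half_pos he) hk1.le
      (by simpa using (half_pos he).le) hk2.le
    have hle := csInf_le ⟨0, fun _ hd => hd.1.le⟩ hmem
    rw [← hδ k] at hle
    have hnonneg : 0 ≤ δ k := hδ k ▸ Real.sInf_nonneg fun _ hd => hd.1.le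
    rw [Real.dist_0_eq_abs, abs_of_nonneg hnonneg]
    linarith
  refine ⟨hne, hδlim, ?_, fun h₀ hh₀ => ⟨?_, ?_⟩⟩
  · have h0 : Tendsto (fun k => ENNReal.ofReal (δ k)) atTop (𝓝 0) := by
      simpa using ENNReal.tendsto_ofReal hδlim
    refine tendsto_of_tendsto_of_tendsto_of_le_of_le tendsto_const_nhds h0 (fun _ => zero_le)
      fun k => ?_
    simp only [hδ k]
    exact hA.infEDist_inflatedFiber_sInf_le (hne k)
  · obtain ⟨h₁, y₁, h1, -, hp⟩ := hlim (Ultrafilter.of atTop) (Ultrafilter.of_le _)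
    obtain rfl := tendsto_nhds_unique (hh₀.mono_left (Ultrafilter.of_le _)) h1
    exact (hA.subset hp).1
  · rw [tendsto_iff_ultrafilter]
    intro U hU
    obtain ⟨h₁, y₁, h1, h2, hp⟩ := hlim U hU
    obtain rfl := tendsto_nhds_unique (hh₀.mono_left hU) h1
    refine tendsto_of_tendsto_of_tendsto_of_le_of_le tendsto_const_nhds
      (tendsto_iff_edist_tendsto_0.1 h2) (fun _ => zero_le) fun k => ?_
    exact Metric.infEDist_le_edist_of_mem (show y₁ ∈ fiber A h₀ (x₀ t₀) from hp)
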